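/- Let $G$ be a finite group acting on an abelian category $\mathcal C$: there are autoequivalences $T^g:\mathcal C\to\mathcal C$ ($g\in G$) and natural isomorphisms $T_2^{g,h}:T^gT^h\to T^{gh}$ and $T_0:\mathrm{id}_{\mathcal C}\to T^1$ such that, for all $g,h,l\in G$ and all objects $M$, $$(T_2^{gh,l})_M\,(T_2^{g,h})_{T^l(M)}=(T_2^{g,hl})_M\,T^g((T_2^{h,l})_M),\qquad (T_2^{g,1})_M\,T^g((T_0)_M)=(T_2^{1,g})_M\,(T_0)_{T^g(M)}=\mathrm{id}_{T^g(M)} .$$ For a subgroup $H\le G$ let $\mathcal C^H$ be the category of $H$-equivariant objects: pairs $(V,\mu)$ of an object $V$ and isomorphisms $\mu^g:T^g(V)\to V$ ($g\in H$) with $\mu^g\,T^g(\mu^h)=\mu^{gh}(T_2^{g,h})_V$ and $\mu^1(T_0)_V=\mathrm{id}_V$; the morphisms are the morphisms of $\mathcal C$ that commute with the $\mu^g$. For $K\le H$ let $\mathrm{Res}_K^H:\mathcal C^H\to\mathcal C^K$ be the functor that forgets the $\mu^g$ with $g\notin K$. For $L\le H$ and a set $\mathcal R$ of representatives of the left cosets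 $H/L$ let $\mathrm{Ind}_L^H:\mathcal C^L\to\mathcal C^H$ be the functor $(V,\mu)\mapsto\bigoplus_{t\in\mathcal R}T^t(V)$, on which $g\in H$ acts by the components $$T^gT^t(V)\xrightarrow{T_2^{g,t}}T^{gt}(V)=T^{sh}(V)\xrightarrow{(T_2^{s,h})^{-1}}T^sT^h(V)\xrightarrow{T^s(\mu^h)}T^s(V),$$ where $s\in\mathcal R$ and $h\in L$ are determined by $gt=sh$. For $x\in G$ put ${}^xL=xLx^{-1}$, and let $c_{L,x}:\mathcal C^L\to\mathcal C^{{}^xL}$ be the functor $(V,\mu)\mapsto T^x(V)$, on which $xhx^{-1}$ ($h\in L$) acts by $$T^{xhx^{-1}}T^x(V)\xrightarrow{T_2^{xhx^{-1},x}}T^{xh}(V)\xrightarrow{(T_2^{x,h})^{-1}}T^xT^h(V)\xrightarrow{T^x(\mu^h)}T^x(V).$$ **Theorem 1.2.** Let $K$ and $L$ be subgroups of a subgroup $H\le G$. Choose representatives of the double cosets $K\backslash H/L$, of $H/L$, and of $K/(K\cap{}^xL)$ for each chosen representative $x$ of a double coset; all choices are arbitrary. 1) There is an isomorphism, natural in $M\in\mathcal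 C^L$, $$\mathrm{Res}_K^H(\mathrm{Ind}_L^H(M))\;\simeq\;\bigoplus_{x\in K\backslash H/L}\mathrm{Ind}_{K\cap{}^xL}^{K}\bigl(\mathrm{Res}_{{}^xL\cap K}^{{}^xL}(c_{L,x}(M))\bigr)\quad\text{in }\mathcal C^K .$$ 2) The isomorphism in 1) can be chosen so that the following holds. Suppose that, for a commutative ring $k$, $\mathcal C$ is a $k$-linear monoidal category (its tensor product is $k$-bilinear) and $G$ acts by $k$-linear monoidal autoequivalences, that is, the $T^g$ are $k$-linear strong monoidal functors and the $T_2^{g,h}$ and $T_0$ are monoidal natural transformations. Then the isomorphism is an isomorphism of $\mathcal C^G$-module functors $\mathcal C^L\to\mathcal C^K$. In 2), each $\mathcal C^H$ is the $\mathcal C^G$-module category with $P\boxtimes V=\mathrm{Res}_H^G(P)\otimes V$ (where $g$ acts by $T^g(P\otimes V)\to T^g(P)\otimes T^g(V)\xrightarrow{\mu_P^g\otimes\mu_V^g}P\otimes V$). The module structure of $\mathrm{Res}$ is the identity; those of $c_{L,x}$ and of $\mathrm{Ind}$ have the components $$T^a(P\otimes V)\to T^a(P)\otimes T^a(V)\xrightarrow{\mu_P^a\otimes1}P\otimes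 T^a(V),$$ with $a=x$, respectively with $a$ running over the chosen representatives; composites and finite direct sums of module functors carry the induced structures. -/

import Mathlib

open CategoryTheory CategoryTheory.Limits MonoidalCategory
open scoped MonoidalLeftAction

universe w w' v u

/-! ## Group actions on categories -/

/-- An action of a group `G` on a category `C`: a monoidal functor from the discrete monoidal
category `G` to the monoidal category of autoequivalences of `C` (with composition).
It consists of autoequivalences `T g`, isomorphisms `T₂^{g,h} : T g ∘ T h ≅ T (g h)` and
`T₀ : id ≅ T 1`, subject to associativity and unitality.
The isomorphism `T₂^{g,h}` is indexed by a triple `g, h, k` with a proof of `g * h = k`, so that no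
transport along equalities of group elements is needed.
When `C` is abelian, each `T g` is automatically exact, being an equivalence. -/
structure CatGroupAction (G : Type w) [Group G] (C : Type u) [Category.{v} C] where
  /-- The functors `T g`. -/
  F : G → C ⥤ C
  isEquivalence : ∀ g, (F g).IsEquivalence
  /-- The isomorphism `T₂^{g,h} : T g (T h M) ≅ T (g h) M`. -/
  mul : ∀ {g h k : G}, g * h = k → (F h ⋙ F g ≅ F k)
  /-- The isomorphism `T₀ : M ≅ T 1 M`. -/
  one : 𝟭 C ≅ F 1
  assoc : ∀ {g h l gh hl ghl : G} (e₁ : g * h = gh) (e₂ : gh * l = ghl)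
    (e₃ : h * l = hl) (e₄ : g * hl = ghl) (M : C),
    (mul e₁).hom.app ((F l).obj M) ≫ (mul e₂).hom.app M =
      (F g).map ((mul e₃).hom.app M) ≫ (mul e₄).hom.app M
  mul_one : ∀ (g : G) (M : C),
    (F g).map (one.hom.app M) ≫ (mul (_root_.mul_one g)).hom.app M = 𝟙 _
  one_mul : ∀ (g : G) (M : C),
    one.hom.app ((F g).obj M) ≫ (mul (_root_.one_mul g)).hom.app M = 𝟙 _

namespace CatGroupAction

variable {G : Type w} [Group G] {C : Type u} [Category.{v} C]

attribute [instance] CatGroupAction.isEquivalence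

/-! ## Equivariant objects -/

/-- The objects of the equivariantization `C^H`: an object `X` of `C` with isomorphisms
`μ^g : T g X ⟶ X` for `g ∈ H`, with `μ^g ∘ T g (μ^h) = μ^{gh} ∘ T₂^{g,h}` and `μ^1 ∘ T₀ = id`. -/
structure Equivariant (T : CatGroupAction G C) (H : Subgroup G) where
  /-- The underlying object. -/
  X : C
  /-- The equivariant structure. -/
  act : ∀ g : G, g ∈ H → ((T.F g).obj X ⟶ X)
  isIso : ∀ (g : G) (hg : g ∈ H), IsIso (act g hg)
  mul : ∀ {g h k : G} (e : g * h = k) (hg : g ∈ H) (hh : h ∈ H) (hk : k ∈ H),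
    (T.F g).map (act h hh) ≫ act g hg = (T.mul e).hom.app X ≫ act k hk
  one : T.one.hom.app X ≫ act 1 H.one_mem = 𝟙 X

attribute [instance] Equivariant.isIso

namespace Equivariant

variable {T : CatGroupAction G C} {H : Subgroup G}

/-- The morphisms of `C^H`: the morphisms of `C` that commute with the equivariant structures. -/
@[ext]
structure Hom (V W : T.Equivariant H) where
  /-- The underlying morphism. -/
  hom : V.X ⟶ W.X
  comm : ∀ (g : G) (hg : g ∈ H), (T.F g).map hom ≫ W.act g hg = V.act g hg ≫ hom

instance : Category (T.Equivariant H) where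
  Hom := Hom
  id V := ⟨𝟙 _, by simp⟩
  comp f g := ⟨f.hom ≫ g.hom, by
    intro a ha
    rw [Functor.map_comp, Category.assoc, g.comm, ← Category.assoc, f.comm, Category.assoc]⟩

@[ext]
theorem hom_ext {V W : T.Equivariant H} {f g : V ⟶ W} (h : f.hom = g.hom) : f = g :=
  Hom.ext h

@[simp] theorem id_hom (V : T.Equivariant H) : Hom.hom (𝟙 V) = 𝟙 V.X := rfl

@[simp] theorem comp_hom {U V W : T.Equivariant H} (f : U ⟶ V) (g : V ⟶ W) :
    (f ≫ g).hom = f.hom ≫ g.hom := rfl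

/-- An isomorphism in `C` that commutes with the equivariant structures is one in `C^H`. -/
@[simps]
def isoMk {V W : T.Equivariant H} (e : V.X ≅ W.X)
    (h : ∀ (g : G) (hg : g ∈ H), (T.F g).map e.hom ≫ W.act g hg = V.act g hg ≫ e.hom) :
    V ≅ W where
  hom := ⟨e.hom, h⟩
  inv := ⟨e.inv, fun g hg => by
    rw [← cancel_mono e.hom, Category.assoc, ← h g hg, ← Category.assoc, ← Functor.map_comp]
    simp⟩
  hom_inv_id := by ext; simp
  inv_hom_id := by ext; simp

/-- The invertibility of the equivariant structure follows from its multiplicativity. -/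
abbrev ofAct (X : C) (act : ∀ g : G, g ∈ H → ((T.F g).obj X ⟶ X))
    (mul : ∀ {g h k : G} (e : g * h = k) (hg : g ∈ H) (hh : h ∈ H) (hk : k ∈ H),
      (T.F g).map (act h hh) ≫ act g hg = (T.mul e).hom.app X ≫ act k hk)
    (one : T.one.hom.app X ≫ act 1 H.one_mem = 𝟙 X) : T.Equivariant H where
  X := X
  act := act
  mul := mul
  one := one
  isIso := by
    have h1 : IsIso (act 1 H.one_mem) := by
      have h2 : IsIso (T.one.hom.app X ≫ act 1 H.one_mem) := by
        rw [one]
        exact (inferInstance : IsIso (𝟙 X))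
      exact IsIso.of_isIso_comp_left (T.one.hom.app X) _
    have key : ∀ g g' (e : g * g' = 1) (hg : g ∈ H) (hg' : g' ∈ H),
        IsIso ((T.F g).map (act g' hg') ≫ act g hg) := by
      intro g g' e hg hg'
      rw [mul e hg hg' H.one_mem]
      infer_instance
    intro g hg
    have hm : Mono (act g hg) := by
      have hk := key g⁻¹ g (inv_mul_cancel g) (H.inv_mem hg) hg
      have hm := mono_of_mono ((T.F g⁻¹).map (act g hg)) (act g⁻¹ (H.inv_mem hg))
      exact (T.F g⁻¹).mono_of_mono_map hm
    have hs : IsSplitEpi (act g hg) := by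
      have hk := key g g⁻¹ (mul_inv_cancel g) hg (H.inv_mem hg)
      exact ⟨⟨⟨inv ((T.F g).map (act g⁻¹ (H.inv_mem hg)) ≫ act g hg) ≫
        (T.F g).map (act g⁻¹ (H.inv_mem hg)), by simp⟩⟩⟩
    exact isIso_of_mono_of_isSplitEpi _

end Equivariant

/-! ## Restriction and conjugation -/

/-- The restriction functor `Res_K^H : C^H ⥤ C^K`, for `K ≤ H`. -/
abbrev res (T : CatGroupAction G C) {K H : Subgroup G} (h : K ≤ H) :
    T.Equivariant H ⥤ T.Equivariant K where
  obj V :=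
    { X := V.X
      act := fun g hg => V.act g (h hg)
      isIso := fun g hg => V.isIso g (h hg)
      mul := fun e hg hh hk => V.mul e (h hg) (h hh) (h hk)
      one := V.one }
  map f := ⟨f.hom, fun g hg => f.comm g (h hg)⟩

@[simp] theorem res_obj_X (T : CatGroupAction G C) {K H : Subgroup G} (h : K ≤ H)
    (V : T.Equivariant H) : ((T.res h).obj V).X = V.X := rfl
@[simp] theorem res_obj_act (T : CatGroupAction G C) {K H : Subgroup G} (h : K ≤ H)
    (V : T.Equivariant H) (g : G) (hg : g ∈ K) :
    ((T.res h).obj V).act g hg = V.act g (h hg) := rfl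
@[simp] theorem res_map_hom (T : CatGroupAction G C) {K H : Subgroup G} (h : K ≤ H)
    {V W : T.Equivariant H} (f : V ⟶ W) : ((T.res h).map f).hom = f.hom := rfl

section Transfer

variable {T : CatGroupAction G C} {L : Subgroup G}

/-- For `V` in `C^L` and `a = b * l` with `l ∈ L`, the composite
`T a V ⟶ T b (T l V) ⟶ T b V` of the inverse of `T₂^{b,l}` and of `T b (μ^l)`. -/
def transfer (V : T.Equivariant L) (a b : G) (h : b⁻¹ * a ∈ L) :
    (T.F a).obj V.X ⟶ (T.F b).obj V.X :=
  (T.mul (mul_inv_cancel_left b a)).inv.app V.X ≫ (T.F b).map (V.act (b⁻¹ * a) h)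

theorem mul_transfer (V : T.Equivariant L) {a b l : G} (e : b * l = a) (hl : l ∈ L)
    (h : b⁻¹ * a ∈ L) :
    (T.mul e).hom.app V.X ≫ transfer V a b h = (T.F b).map (V.act l hl) := by
  obtain rfl : l = b⁻¹ * a := by rw [← e]; simp
  simp [transfer]

theorem transfer_eq (V : T.Equivariant L) {a b l : G} (e : b * l = a) (hl : l ∈ L)
    (h : b⁻¹ * a ∈ L) :
    transfer V a b h = (T.mul e).inv.app V.X ≫ (T.F b).map (V.act l hl) := by
  rw [← mul_transfer V e hl h]; simp

theorem transfer_self (V : T.Equivariant L) (a : G) (h : a⁻¹ * a ∈ L) :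
    transfer V a a h = 𝟙 _ := by
  rw [transfer_eq V (_root_.mul_one a) L.one_mem,
    ← cancel_epi ((T.mul (_root_.mul_one a)).hom.app V.X)]
  have h1 := congrArg (T.F a).map V.one
  have h2 := T.mul_one a V.X
  rw [← cancel_epi ((T.F a).map (T.one.hom.app V.X))]
  rw [Iso.hom_inv_id_app_assoc, ← Functor.map_comp, h1, Category.comp_id, h2]
  exact (T.F a).map_id _

theorem transfer_trans (V : T.Equivariant L) {a b c : G} (h₁ : b⁻¹ * a ∈ L) (h₂ : c⁻¹ * b ∈ L)
    (h₃ : c⁻¹ * a ∈ L) :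
    transfer V a b h₁ ≫ transfer V b c h₂ = transfer V a c h₃ := by
  have e₁ : b * (b⁻¹ * a) = a := by group
  have e₂ : c * (c⁻¹ * b) = b := by group
  have e₃ : (c⁻¹ * b) * (b⁻¹ * a) = c⁻¹ * a := by group
  have e₄ : c * (c⁻¹ * a) = a := by group
  have h := T.assoc e₂ e₁ e₃ e₄ V.X
  have h' := (T.mul e₂).hom.naturality (V.act (b⁻¹ * a) h₁)
  rw [← cancel_epi ((T.mul e₁).hom.app V.X), ← Category.assoc, mul_transfer V e₁ h₁,
    ← cancel_epi ((T.mul e₂).hom.app ((T.F (b⁻¹ * a)).obj V.X)),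
    reassoc_of% h, mul_transfer V e₄ h₃, ← Functor.map_comp, ← V.mul e₃ h₂ h₁ h₃,
    ← reassoc_of% h', mul_transfer V e₂ h₂]
  simp

theorem map_transfer (V : T.Equivariant L) {g a b ga gb : G} (ea : g * a = ga) (eb : g * b = gb)
    (h : b⁻¹ * a ∈ L) (h' : gb⁻¹ * ga ∈ L) :
    (T.F g).map (transfer V a b h) ≫ (T.mul eb).hom.app V.X =
      (T.mul ea).hom.app V.X ≫ transfer V ga gb h' := by
  have e₁ : b * (b⁻¹ * a) = a := by group
  have e₂ : gb * (b⁻¹ * a) = ga := by rw [← ea, ← eb]; group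
  have h3 := T.assoc eb e₂ e₁ ea V.X
  rw [← cancel_epi ((T.F g).map ((T.mul e₁).hom.app V.X)), ← Category.assoc,
    ← Functor.map_comp, mul_transfer V e₁ h, ← Category.assoc, ← h3, Category.assoc,
    mul_transfer V e₂ h, ← NatTrans.naturality]
  rfl

theorem transfer_naturality {V W : T.Equivariant L} (f : V ⟶ W) (a b : G) (h : b⁻¹ * a ∈ L) :
    (T.F a).map f.hom ≫ transfer W a b h = transfer V a b h ≫ (T.F b).map f.hom := by
  have e : b * (b⁻¹ * a) = a := by group
  rw [← cancel_epi ((T.mul e).hom.app V.X), ← Category.assoc, ← NatTrans.naturality,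
    Category.assoc, mul_transfer W e h, ← Category.assoc, mul_transfer V e h]
  simp [← Functor.map_comp, f.comm]

/-- The morphism `T g (T a V) ⟶ T (g a) V = T (b l) V ⟶ T b (T l V) ⟶ T b V`, where `g a = b l`
with `l ∈ L`. -/
def shift (V : T.Equivariant L) (g a b : G) (h : b⁻¹ * (g * a) ∈ L) :
    (T.F g).obj ((T.F a).obj V.X) ⟶ (T.F b).obj V.X :=
  (T.mul rfl).hom.app V.X ≫ transfer V (g * a) b h

theorem shift_naturality {V W : T.Equivariant L} (f : V ⟶ W) (g a b : G)
    (h : b⁻¹ * (g * a) ∈ L) :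
    (T.F g).map ((T.F a).map f.hom) ≫ shift W g a b h = shift V g a b h ≫ (T.F b).map f.hom := by
  rw [shift, shift, Category.assoc, ← transfer_naturality, ← Category.assoc, ← Category.assoc,
    ← NatTrans.naturality]
  rfl

theorem shift_mul (V : T.Equivariant L) {g g' k a b c : G} (e : g * g' = k)
    (h₁ : b⁻¹ * (g' * a) ∈ L) (h₂ : c⁻¹ * (g * b) ∈ L) (h₃ : c⁻¹ * (k * a) ∈ L) :
    (T.F g).map (shift V g' a b h₁) ≫ shift V g b c h₂ =
      (T.mul e).hom.app ((T.F a).obj V.X) ≫ shift V k a c h₃ := by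
  have e' : g * (g' * a) = k * a := by rw [← e, mul_assoc]
  have h4 : (g * b)⁻¹ * (k * a) ∈ L := by
    rw [← e]; convert h₁ using 1; group
  rw [shift, shift, shift, Functor.map_comp, Category.assoc,
    ← Category.assoc ((T.F g).map (transfer V _ _ _)), map_transfer V e' rfl h₁ h4,
    Category.assoc, transfer_trans V h4 h₂ h₃, ← Category.assoc, ← Category.assoc,
    ← T.assoc e rfl rfl e']

theorem shift_one (V : T.Equivariant L) (a : G) (h : a⁻¹ * (1 * a) ∈ L) :
    T.one.hom.app ((T.F a).obj V.X) ≫ shift V 1 a a h = 𝟙 _ := by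
  have h1 := T.one_mul a V.X
  have h2 : ∀ (b : G) (e : 1 * a = b) (e' : b = a) (h : a⁻¹ * b ∈ L),
      T.one.hom.app ((T.F a).obj V.X) ≫ (T.mul e).hom.app V.X ≫ transfer V b a h = 𝟙 _ := by
    rintro b e rfl h
    rw [transfer_self, Category.comp_id, h1]
  exact h2 _ rfl (_root_.one_mul a) h

end Transfer

/-- The conjugate subgroup `ˣL = x L x⁻¹`. -/
def conjSubgroup (x : G) (L : Subgroup G) : Subgroup G :=
  L.map (MulAut.conj x).toMonoidHom

theorem mem_conjSubgroup {x g : G} {L : Subgroup G} :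
    g ∈ conjSubgroup x L ↔ x⁻¹ * (g * x) ∈ L := by
  rw [conjSubgroup, Subgroup.mem_map]
  constructor
  · rintro ⟨l, hl, rfl⟩
    convert hl using 1
    simp [MulAut.conj_apply, mul_assoc]
  · intro h
    exact ⟨_, h, by simp [MulAut.conj_apply, mul_assoc]⟩

/-- The conjugation functor `c_{L,x} : C^L ⥤ C^{ˣL}`, sending `V` to `T x V` with the
equivariant structure, for `g = x l x⁻¹`,
`T g (T x V) ⟶ T (g x) V = T (x l) V ⟶ T x (T l V) ⟶ T x V`. -/
def conj (T : CatGroupAction G C) (L : Subgroup G) (x : G) :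
    T.Equivariant L ⥤ T.Equivariant (conjSubgroup x L) where
  obj V := Equivariant.ofAct ((T.F x).obj V.X)
    (fun g hg => shift V g x x (mem_conjSubgroup.1 hg))
    (fun e _ _ _ => shift_mul V e _ _ _)
    (shift_one V x _)
  map f := ⟨(T.F x).map f.hom, fun g hg => shift_naturality f g x x _⟩

@[simp] theorem conj_obj_X (T : CatGroupAction G C) (L : Subgroup G) (x : G)
    (V : T.Equivariant L) : ((T.conj L x).obj V).X = (T.F x).obj V.X := rfl
@[simp] theorem conj_obj_act (T : CatGroupAction G C) (L : Subgroup G) (x : G)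
    (V : T.Equivariant L) (g : G) (hg : g ∈ conjSubgroup x L) :
    ((T.conj L x).obj V).act g hg = shift V g x x (mem_conjSubgroup.1 hg) := rfl
@[simp] theorem conj_map_hom (T : CatGroupAction G C) (L : Subgroup G) (x : G)
    {V W : T.Equivariant L} (f : V ⟶ W) : ((T.conj L x).map f).hom = (T.F x).map f.hom := rfl

/-! ## Additive structure -/

section Additive

variable [Abelian C]

attribute [local instance] Abelian.hasFiniteBiproducts

instance additive (T : CatGroupAction G C) (g : G) : (T.F g).Additive :=
  Functor.additive_of_preserves_binary_products _

namespace Equivariant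

variable {T : CatGroupAction G C} {H : Subgroup G}

instance (V W : T.Equivariant H) : Zero (V ⟶ W) := ⟨⟨0, by simp⟩⟩
instance (V W : T.Equivariant H) : Add (V ⟶ W) :=
  ⟨fun f g => ⟨f.hom + g.hom, by simp [Functor.map_add, f.comm, g.comm]⟩⟩
instance (V W : T.Equivariant H) : Neg (V ⟶ W) :=
  ⟨fun f => ⟨-f.hom, by simp [Functor.map_neg, f.comm]⟩⟩
instance (V W : T.Equivariant H) : Sub (V ⟶ W) :=
  ⟨fun f g => ⟨f.hom - g.hom, by simp [Functor.map_sub, f.comm, g.comm]⟩⟩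
instance (V W : T.Equivariant H) : SMul ℕ (V ⟶ W) :=
  ⟨fun n f => ⟨n • f.hom, by simp [f.comm]⟩⟩
instance (V W : T.Equivariant H) : SMul ℤ (V ⟶ W) :=
  ⟨fun n f => ⟨n • f.hom, by simp [f.comm]⟩⟩

instance (V W : T.Equivariant H) : AddCommGroup (V ⟶ W) :=
  Function.Injective.addCommGroup (fun f : V ⟶ W => f.hom) (fun _ _ h => hom_ext h)
    rfl (fun _ _ => rfl) (fun _ => rfl) (fun _ _ => rfl) (fun _ _ => rfl) (fun _ _ => rfl)

@[simp] theorem zero_hom (V W : T.Equivariant H) : Hom.hom (0 : V ⟶ W) = 0 := rfl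
@[simp] theorem add_hom {V W : T.Equivariant H} (f g : V ⟶ W) :
    (f + g).hom = f.hom + g.hom := rfl

/-- `C^H` is preadditive, with the addition of morphisms of `C`. -/
instance : Preadditive (T.Equivariant H) where
  add_comp _ _ _ f g h := by ext; simp
  comp_add _ _ _ f g h := by ext; simp

/-- The forgetful functor `C^H ⥤ C`. -/
@[simps]
def forget (T : CatGroupAction G C) (H : Subgroup G) : T.Equivariant H ⥤ C where
  obj V := V.X
  map f := f.hom

instance : (forget T H).Faithful where
  map_injective h := hom_ext h

instance : (forget T H).Additive where

@[simp] theorem sum_hom {J : Type*} (s : Finset J) {V W : T.Equivariant H} (f : J → (V ⟶ W)) :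
    (∑ j ∈ s, f j).hom = ∑ j ∈ s, (f j).hom :=
  (forget T H).map_sum f s

/-- The direct sum of a finite family of equivariant objects. -/
noncomputable def sum {J : Type*} [Finite J] (V : J → T.Equivariant H) : T.Equivariant H :=
  ofAct (⨁ fun j => (V j).X)
    (fun g hg => biproduct.lift fun j =>
      (T.F g).map (biproduct.π (fun j => (V j).X) j) ≫ (V j).act g hg)
    (by
      intro g h k e hg hh hk
      apply biproduct.hom_ext
      intro j
      simp only [Category.assoc, biproduct.lift_π]
      rw [← Category.assoc, ← Functor.map_comp, biproduct.lift_π, Functor.map_comp,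
        Category.assoc, (V j).mul e hg hh hk, ← Category.assoc, ← Category.assoc,
        ← NatTrans.naturality]
      rfl)
    (by
      apply biproduct.hom_ext
      intro j
      have h1 := (V j).one
      have h2 := T.one.hom.naturality (biproduct.π (fun j => (V j).X) j)
      simp only [Category.assoc, biproduct.lift_π]
      rw [← Category.assoc, ← h2, Category.assoc, h1]
      simp)

instance : HasFiniteBiproducts (T.Equivariant H) where
  out n :=
    { has_biproduct := fun V => by
        classical
        let b : Bicone V :=
          { pt := sum V
            π := fun j => ⟨biproduct.π (fun j => (V j).X) j, fun g hg => by simp [sum, ofAct]⟩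
            ι := fun j => ⟨biproduct.ι (fun j => (V j).X) j, fun g hg => by
              apply biproduct.hom_ext
              intro i
              simp only [sum, ofAct, Category.assoc, biproduct.lift_π]
              rw [← Category.assoc, ← Functor.map_comp]
              by_cases hij : j = i
              · subst hij
                simp
              · simp [biproduct.ι_π_ne _ hij]⟩
            ι_π := fun i j => by
              ext
              by_cases hij : i = j
              · subst hij
                simp only [comp_hom, dite_true, eqToHom_refl, id_hom]
                exact biproduct.ι_π_self (fun j => (V j).X) i
              · simp only [comp_hom, hij, dite_false, zero_hom]
                exact biproduct.ι_π_ne (fun j => (V j).X) hij }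
        refine hasBiproduct_of_total b ?_
        ext
        simp only [sum_hom, comp_hom, id_hom]
        exact biproduct.total }

end Equivariant

/-! ## Induction -/

/-- A choice of representatives of the left cosets `H / L` of `L ≤ H`. -/
structure LeftCosetReps (L H : Subgroup G) where
  rep : H ⧸ L.subgroupOf H → H
  mk_rep : ∀ q, (QuotientGroup.mk (rep q) : H ⧸ L.subgroupOf H) = q

/-- A choice of representatives of the double cosets `K \ H / L`, for `K, L ≤ H`. -/
structure DoubleCosetReps (K L H : Subgroup G) where
  rep : DoubleCoset.Quotient (K.subgroupOf H : Set H) (L.subgroupOf H : Set H) → H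
  mk_rep : ∀ q, DoubleCoset.mk (K.subgroupOf H) (L.subgroupOf H) (rep q) = q

instance [Finite G] (K L H : Subgroup G) :
    Finite (DoubleCoset.Quotient (K.subgroupOf H : Set H) (L.subgroupOf H : Set H)) :=
  inferInstanceAs (Finite (Quotient _))

theorem LeftCosetReps.mem {L H : Subgroup G} (r : LeftCosetReps L H) {g : G} {hg : g ∈ H}
    {q q' : H ⧸ L.subgroupOf H} (e : (⟨g, hg⟩ : H) • q' = q) :
    (r.rep q : G)⁻¹ * (g * (r.rep q' : G)) ∈ L := by
  have h : (QuotientGroup.mk (r.rep q) : H ⧸ L.subgroupOf H) =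
      QuotientGroup.mk ((⟨g, hg⟩ : H) * r.rep q') := by
    rw [r.mk_rep, ← e]
    conv_lhs => rw [← r.mk_rep q']
    rfl
  exact Subgroup.mem_subgroupOf.1 (QuotientGroup.eq.1 h)

section Ind

variable [Finite G] (T : CatGroupAction G C) {L H : Subgroup G} (r : LeftCosetReps L H)

/-- The object `⨁ T t V`, over the representatives `t` of the cosets `H / L`. -/
noncomputable abbrev indX (V : T.Equivariant L) : C :=
  ⨁ fun q : H ⧸ L.subgroupOf H => (T.F (r.rep q : G)).obj V.X

/-- The equivariant structure of the induced object. Its component from `T g (T t V)` to `T s V`,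
for representatives `s, t` with `g t = s h` and `h ∈ L`, is the composite
`T g (T t V) ⟶ T (g t) V = T (s h) V ⟶ T s (T h V) ⟶ T s V`; the other components are `0`. -/
noncomputable def indAct (V : T.Equivariant L) (g : G) (hg : g ∈ H) :
    (T.F g).obj (indX T r V) ⟶ indX T r V :=
  biproduct.lift fun s =>
    (T.F g).map (biproduct.π _ ((⟨g, hg⟩ : H)⁻¹ • s)) ≫
      shift V g (r.rep ((⟨g, hg⟩ : H)⁻¹ • s)) (r.rep s) (r.mem (smul_inv_smul (⟨g, hg⟩ : H) s))

theorem indAct_π (V : T.Equivariant L) (g : G) (hg : g ∈ H) {s t : H ⧸ L.subgroupOf H}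
    (e : (⟨g, hg⟩ : H) • t = s) :
    indAct T r V g hg ≫ biproduct.π _ s =
      (T.F g).map (biproduct.π _ t) ≫ shift V g (r.rep t) (r.rep s) (r.mem e) := by
  obtain rfl : t = (⟨g, hg⟩ : H)⁻¹ • s := by rw [← e, inv_smul_smul]
  simp [indAct]

/-- The induced object `Ind_L^H V`. -/
noncomputable abbrev indObj (V : T.Equivariant L) : T.Equivariant H :=
  Equivariant.ofAct (indX T r V) (indAct T r V)
    (by
      intro g g' k e hg hg' hk
      apply biproduct.hom_ext
      intro s
      have e₁ : (⟨g, hg⟩ : H) • ((⟨g, hg⟩ : H)⁻¹ • s) = s := smul_inv_smul _ _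
      have e₂ : (⟨g', hg'⟩ : H) • ((⟨g', hg'⟩ : H)⁻¹ • (⟨g, hg⟩ : H)⁻¹ • s) =
        (⟨g, hg⟩ : H)⁻¹ • s := smul_inv_smul _ _
      have e₃ : (⟨k, hk⟩ : H) • ((⟨g', hg'⟩ : H)⁻¹ • (⟨g, hg⟩ : H)⁻¹ • s) = s := by
        have h : (⟨k, hk⟩ : H) = ⟨g, hg⟩ * ⟨g', hg'⟩ := Subtype.ext e.symm
        rw [h, mul_smul, smul_inv_smul, smul_inv_smul]
      rw [Category.assoc, Category.assoc, indAct_π T r V g hg e₁, indAct_π T r V k hk e₃,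
        ← Category.assoc, ← Functor.map_comp, indAct_π T r V g' hg' e₂, Functor.map_comp,
        Category.assoc, shift_mul V e (r.mem e₂) (r.mem e₁) (r.mem e₃), ← Category.assoc,
        ← Category.assoc, ← NatTrans.naturality]
      rfl)
    (by
      apply biproduct.hom_ext
      intro s
      have e : (⟨1, H.one_mem⟩ : H) • s = s := one_smul H s
      have h1 := T.one.hom.naturality
        (biproduct.π (fun q : H ⧸ L.subgroupOf H => (T.F (r.rep q : G)).obj V.X) s)
      rw [Category.assoc, indAct_π T r V 1 H.one_mem e, ← Category.assoc, ← h1, Category.assoc,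
        shift_one]
      simp)

/-- The morphism underlying `Ind_L^H f`. -/
noncomputable abbrev indMap {V W : T.Equivariant L} (f : V ⟶ W) : indX T r V ⟶ indX T r W :=
  biproduct.map fun s => (T.F (r.rep s : G)).map f.hom

theorem indMap_comm {V W : T.Equivariant L} (f : V ⟶ W) (g : G) (hg : g ∈ H) :
    (T.F g).map (indMap T r f) ≫ indAct T r W g hg = indAct T r V g hg ≫ indMap T r f := by
  apply biproduct.hom_ext
  intro s
  have e : (⟨g, hg⟩ : H) • ((⟨g, hg⟩ : H)⁻¹ • s) = s := smul_inv_smul _ _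
  rw [Category.assoc, Category.assoc, indAct_π T r W g hg e, biproduct.map_π, ← Category.assoc,
    ← Functor.map_comp, biproduct.map_π, ← Category.assoc, indAct_π T r V g hg e,
    Functor.map_comp, Category.assoc, Category.assoc, shift_naturality]

/-- The induction functor `Ind_L^H : C^L ⥤ C^H` attached to a choice of representatives of the
left cosets of `L` in `H`. -/
noncomputable def ind : T.Equivariant L ⥤ T.Equivariant H where
  obj V := indObj T r V
  map f := ⟨indMap T r f, indMap_comm T r f⟩
  map_id V := Equivariant.hom_ext (by
    change indMap T r (𝟙 V) = 𝟙 (indX T r V)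
    apply biproduct.hom_ext
    intro s
    simp)
  map_comp f g := Equivariant.hom_ext (by
    change indMap T r (f ≫ g) = indMap T r f ≫ indMap T r g
    apply biproduct.hom_ext
    intro s
    simp)

@[simp] theorem ind_obj_X (V : T.Equivariant L) : ((T.ind r).obj V).X = indX T r V := rfl
@[simp] theorem ind_obj_act (V : T.Equivariant L) (g : G) (hg : g ∈ H) :
    ((T.ind r).obj V).act g hg = indAct T r V g hg := rfl
@[simp] theorem ind_map_hom {V W : T.Equivariant L} (f : V ⟶ W) :
    ((T.ind r).map f).hom = indMap T r f := rfl

end Ind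

end Additive

/-- The direct sum of a finite family of functors, computed objectwise. -/
noncomputable abbrev functorSum {D : Type*} [Category* D] {E : Type*} [Category* E]
    [HasZeroMorphisms E] [HasFiniteBiproducts E] {J : Type*} [Finite J] (F : J → D ⥤ E) :
    D ⥤ E where
  obj X := ⨁ fun j => (F j).obj X
  map f := biproduct.map fun j => (F j).map f

theorem functorSum_map_π {D : Type*} [Category* D] {E : Type*} [Category* E]
    [HasZeroMorphisms E] [HasFiniteBiproducts E] {J : Type*} [Finite J] (F : J → D ⥤ E)
    {X Y : D} (f : X ⟶ Y) (j : J) :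
    (functorSum F).map f ≫ biproduct.π (fun j => (F j).obj Y) j =
      biproduct.π (fun j => (F j).obj X) j ≫ (F j).map f :=
  biproduct.map_π (fun j => (F j).map f) j

/-! ## Actions by monoidal autoequivalences -/

/-- The structure of an action by monoidal autoequivalences on an action `T` of `G` on a monoidal
category: each `T g` is a (strong) monoidal functor, and the isomorphisms `T₂^{g,h}` and `T₀` are
monoidal natural transformations. -/
class MonoidalAction (T : CatGroupAction G C) [MonoidalCategory C] where
  monoidal : ∀ g : G, (T.F g).Monoidal
  mul_isMonoidal : ∀ {g h k : G} (e : g * h = k), NatTrans.IsMonoidal (T.mul e).hom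
  one_isMonoidal : NatTrans.IsMonoidal T.one.hom

instance (T : CatGroupAction G C) [MonoidalCategory C] [T.MonoidalAction] (g : G) :
    (T.F g).Monoidal :=
  MonoidalAction.monoidal g

instance (T : CatGroupAction G C) [MonoidalCategory C] [T.MonoidalAction] {g h k : G}
    (e : g * h = k) : NatTrans.IsMonoidal (T.mul e).hom :=
  MonoidalAction.mul_isMonoidal e

instance (T : CatGroupAction G C) [MonoidalCategory C] [T.MonoidalAction] :
    NatTrans.IsMonoidal T.one.hom :=
  MonoidalAction.one_isMonoidal

section Monoidal

open Functor.OplaxMonoidal Functor.LaxMonoidal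

variable [MonoidalCategory C] (T : CatGroupAction G C) [T.MonoidalAction]

theorem app_δ {F F' : C ⥤ C} [F.Monoidal] [F'.Monoidal] (τ : F ⟶ F') [NatTrans.IsMonoidal τ]
    (X Y : C) : τ.app (X ⊗ Y) ≫ δ F' X Y = δ F X Y ≫ (τ.app X ⊗ₘ τ.app Y) := by
  rw [← cancel_epi (μ F X Y), ← Category.assoc, NatTrans.IsMonoidal.tensor]
  simp

theorem app_η {F F' : C ⥤ C} [F.Monoidal] [F'.Monoidal] (τ : F ⟶ F') [NatTrans.IsMonoidal τ] :
    τ.app (𝟙_ C) ≫ η F' = η F := by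
  rw [← cancel_epi (ε F), ← Category.assoc, NatTrans.IsMonoidal.unit]
  simp

theorem mul_δ {g h k : G} (e : g * h = k) (X Y : C) :
    (T.mul e).hom.app (X ⊗ Y) ≫ δ (T.F k) X Y =
      (T.F g).map (δ (T.F h) X Y) ≫ δ (T.F g) _ _ ≫
        ((T.mul e).hom.app X ⊗ₘ (T.mul e).hom.app Y) := by
  rw [app_δ]
  simp

theorem mul_η {g h k : G} (e : g * h = k) :
    (T.mul e).hom.app (𝟙_ C) ≫ η (T.F k) = (T.F g).map (η (T.F h)) ≫ η (T.F g) := by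
  rw [app_η]
  simp

theorem one_δ (X Y : C) :
    T.one.hom.app (X ⊗ Y) ≫ δ (T.F 1) X Y = T.one.hom.app X ⊗ₘ T.one.hom.app Y := by
  rw [app_δ]
  simp

theorem one_η : T.one.hom.app (𝟙_ C) ≫ η (T.F 1) = 𝟙 _ := by
  rw [app_η]
  simp

namespace Equivariant

variable {T} {H : Subgroup G}

/-- The tensor product of equivariant objects, with the equivariant structure
`T g (V ⊗ W) ⟶ T g V ⊗ T g W ⟶ V ⊗ W`. -/
abbrev tensor (V W : T.Equivariant H) : T.Equivariant H :=
  ofAct (V.X ⊗ W.X) (fun g hg => δ (T.F g) V.X W.X ≫ (V.act g hg ⊗ₘ W.act g hg))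
    (by
      intro g h k e hg hh hk
      rw [Functor.map_comp, Category.assoc, ← δ_natural_assoc, tensorHom_comp_tensorHom,
        V.mul e hg hh hk, W.mul e hg hh hk, ← tensorHom_comp_tensorHom, reassoc_of% mul_δ T e])
    (by rw [reassoc_of% one_δ T, tensorHom_comp_tensorHom, V.one, W.one, id_tensorHom_id])

/-- The unit object with the equivariant structure `T g 𝟙 ⟶ 𝟙`. -/
abbrev unit : T.Equivariant H :=
  ofAct (𝟙_ C) (fun g _ => η (T.F g)) (fun e _ _ _ => (mul_η T e).symm) (one_η T)

theorem tensor_act (V W : T.Equivariant H) (g : G) (hg : g ∈ H) :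
    (tensor V W).act g hg = δ (T.F g) V.X W.X ≫ (V.act g hg ⊗ₘ W.act g hg) := rfl

/-- The tensor product of morphisms of equivariant objects. -/
def tensorMap {V V' W W' : T.Equivariant H} (f : V ⟶ V') (f' : W ⟶ W') :
    tensor V W ⟶ tensor V' W' :=
  ⟨f.hom ⊗ₘ f'.hom, fun g hg => by
    rw [tensor_act, tensor_act, ← δ_natural_assoc, Category.assoc, tensorHom_comp_tensorHom,
      tensorHom_comp_tensorHom, f.comm, f'.comm]⟩

instance : MonoidalCategoryStruct (T.Equivariant H) where
  tensorObj := tensor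
  whiskerLeft V _ _ f := ⟨V.X ◁ f.hom, by simpa [tensorMap] using (tensorMap (𝟙 V) f).comm⟩
  whiskerRight f W := ⟨f.hom ▷ W.X, by simpa [tensorMap] using (tensorMap f (𝟙 W)).comm⟩
  tensorHom := tensorMap
  tensorUnit := unit
  associator U V W := isoMk (α_ U.X V.X W.X) (by
    intro g hg
    rw [tensor_act, tensor_act, tensor_act, tensor_act]
    have h := associativity_assoc (T.F g) U.X V.X W.X
      (U.act g hg ⊗ₘ V.act g hg ⊗ₘ W.act g hg)
    calc
      _ = (T.F g).map (α_ U.X V.X W.X).hom ≫ δ (T.F g) U.X (V.X ⊗ W.X) ≫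
          (T.F g).obj U.X ◁ δ (T.F g) V.X W.X ≫ (U.act g hg ⊗ₘ V.act g hg ⊗ₘ W.act g hg) := by
        simp [MonoidalCategory.tensorHom_def']
      _ = _ := by
        rw [← h, ← associator_naturality]
        simp [MonoidalCategory.tensorHom_def])
  leftUnitor V := isoMk (λ_ V.X) (by
    intro g hg
    rw [tensor_act, Category.assoc]
    have h := left_unitality_hom_assoc (T.F g) V.X (V.act g hg)
    rw [← h, MonoidalCategory.tensorHom_def]
    simp)
  rightUnitor V := isoMk (ρ_ V.X) (by
    intro g hg
    rw [tensor_act, Category.assoc]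
    have h := right_unitality_hom_assoc (T.F g) V.X (V.act g hg)
    rw [← h, MonoidalCategory.tensorHom_def']
    simp)

section

variable (U V W : T.Equivariant H)

@[simp] theorem tensorObj_X : (V ⊗ W).X = V.X ⊗ W.X := rfl
@[simp] theorem tensorObj_act (g : G) (hg : g ∈ H) :
    (V ⊗ W).act g hg = δ (T.F g) V.X W.X ≫ (V.act g hg ⊗ₘ W.act g hg) := rfl
@[simp] theorem tensorUnit_X : (𝟙_ (T.Equivariant H)).X = 𝟙_ C := rfl
@[simp] theorem tensorUnit_act (g : G) (hg : g ∈ H) :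
    (𝟙_ (T.Equivariant H)).act g hg = η (T.F g) := rfl
@[simp] theorem tensorHom_hom {V V' W W' : T.Equivariant H} (f : V ⟶ V') (f' : W ⟶ W') :
    (f ⊗ₘ f').hom = f.hom ⊗ₘ f'.hom := rfl
@[simp] theorem whiskerLeft_hom {W W' : T.Equivariant H} (f : W ⟶ W') :
    (V ◁ f).hom = V.X ◁ f.hom := rfl
@[simp] theorem whiskerRight_hom {V V' : T.Equivariant H} (f : V ⟶ V') :
    (f ▷ W).hom = f.hom ▷ W.X := rfl
@[simp] theorem associator_hom_hom : (α_ U V W).hom.hom = (α_ U.X V.X W.X).hom := rfl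
@[simp] theorem associator_inv_hom : (α_ U V W).inv.hom = (α_ U.X V.X W.X).inv := rfl
@[simp] theorem leftUnitor_hom_hom : (λ_ V).hom.hom = (λ_ V.X).hom := rfl
@[simp] theorem leftUnitor_inv_hom : (λ_ V).inv.hom = (λ_ V.X).inv := rfl
@[simp] theorem rightUnitor_hom_hom : (ρ_ V).hom.hom = (ρ_ V.X).hom := rfl
@[simp] theorem rightUnitor_inv_hom : (ρ_ V).inv.hom = (ρ_ V.X).inv := rfl

end

/-- `C^H` is a monoidal category; associators and unitors are those of `C`. -/
instance : MonoidalCategory (T.Equivariant H) where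
  tensorHom_def f g := by ext; simp [MonoidalCategory.tensorHom_def]
  id_tensorHom_id V W := by ext; simp
  tensorHom_comp_tensorHom f₁ f₂ g₁ g₂ := by ext; simp
  whiskerLeft_id V W := by ext; simp
  id_whiskerRight V W := by ext; simp
  associator_naturality f g h := by ext; simp
  leftUnitor_naturality f := by ext; simp
  rightUnitor_naturality f := by ext; simp
  pentagon U V W X := by ext; simp
  triangle V W := by ext; simp

/-- `C^H` is a left module category over `C^G`, with `M ⊠ V = Res_H^G M ⊗ V`. -/
instance : MonoidalLeftAction (T.Equivariant (⊤ : Subgroup G)) (T.Equivariant H) where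
  actionObj M V := (T.res le_top).obj M ⊗ V
  actionHomLeft f V := (T.res le_top).map f ▷ V
  actionHomRight M _ _ f := (T.res le_top).obj M ◁ f
  actionHom f f' := (T.res le_top).map f ⊗ₘ f'
  actionAssocIso M N V := α_ ((T.res le_top).obj M) ((T.res le_top).obj N) V
  actionUnitIso V := λ_ V
  actionHom_def f g := by ext; simp [MonoidalCategory.tensorHom_def]
  actionHom_comp f₁ f₂ g₁ g₂ := by ext; simp
  actionAssocIso_hom_naturality f g h := by ext; simp
  actionUnitIso_hom_naturality f := by ext; simp
  whiskerLeft_actionHomLeft M _ _ f V := by ext; simp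
  whiskerRight_actionHomLeft N f V := by ext; simp
  associator_actionHom M N P V := by ext; simp
  leftUnitor_actionHom M V := by ext; simp
  rightUnitor_actionHom M V := by ext; simp
  actionHomRight_id M V := by ext; simp
  id_actionHomLeft M V := by ext; simp

end Equivariant

/-- The canonical morphism `T a (M ⊗ X) ⟶ T a M ⊗ T a X ⟶ M ⊗ T a X`, for `M` in `C^G`. -/
def lin (M : T.Equivariant ⊤) (X : C) (a : G) :
    (T.F a).obj (M.X ⊗ X) ⟶ M.X ⊗ (T.F a).obj X :=
  δ (T.F a) M.X X ≫ M.act a (Subgroup.mem_top a) ▷ (T.F a).obj X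

section lin

variable {T}

instance (M : T.Equivariant ⊤) (X : C) (a : G) : IsIso (lin T M X a) := by
  unfold lin
  infer_instance

/-- `lin` as an isomorphism. -/
@[simps]
noncomputable def linIso (M : T.Equivariant ⊤) (X : C) (a : G) :
    (T.F a).obj (M.X ⊗ X) ≅ M.X ⊗ (T.F a).obj X where
  hom := lin T M X a
  inv := inv (lin T M X a)

theorem lin_natural_left {M N : T.Equivariant ⊤} (f : M ⟶ N) (X : C) (a : G) :
    (T.F a).map (f.hom ▷ X) ≫ lin T N X a = lin T M X a ≫ f.hom ▷ _ := by
  rw [lin, lin, ← δ_natural_left_assoc, Category.assoc, ← comp_whiskerRight,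
    ← comp_whiskerRight, f.comm]

theorem lin_natural_right (M : T.Equivariant ⊤) {X Y : C} (f : X ⟶ Y) (a : G) :
    (T.F a).map (M.X ◁ f) ≫ lin T M Y a = lin T M X a ≫ M.X ◁ (T.F a).map f := by
  rw [lin, lin, ← δ_natural_right_assoc, Category.assoc, whisker_exchange]

theorem lin_assoc (M N : T.Equivariant ⊤) (X : C) (a : G) :
    lin T (M ⊗ N) X a ≫ (α_ M.X N.X ((T.F a).obj X)).hom =
      (T.F a).map (α_ M.X N.X X).hom ≫ lin T M (N.X ⊗ X) a ≫ M.X ◁ lin T N X a := by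
  have h := associativity_assoc (T.F a) M.X N.X X
    ((M.act a (Subgroup.mem_top a) ⊗ₘ N.act a (Subgroup.mem_top a) ⊗ₘ 𝟙 ((T.F a).obj X)))
  have h' : (T.F a).obj M.X ◁ δ (T.F a) N.X X ≫
      (M.act a (Subgroup.mem_top a) ⊗ₘ N.act a (Subgroup.mem_top a) ⊗ₘ 𝟙 ((T.F a).obj X)) =
      M.act a (Subgroup.mem_top a) ▷ (T.F a).obj (N.X ⊗ X) ≫ M.X ◁ δ (T.F a) N.X X ≫
        M.X ◁ N.act a (Subgroup.mem_top a) ▷ (T.F a).obj X := by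
    rw [MonoidalCategory.tensorHom_def, tensorHom_id, whisker_exchange_assoc]
  simp only [lin]
  calc
    _ = δ (T.F a) (M.X ⊗ N.X) X ≫ δ (T.F a) M.X N.X ▷ (T.F a).obj X ≫
        (α_ ((T.F a).obj M.X) ((T.F a).obj N.X) ((T.F a).obj X)).hom ≫
        (M.act a (Subgroup.mem_top a) ⊗ₘ N.act a (Subgroup.mem_top a) ⊗ₘ
          𝟙 ((T.F a).obj X)) := by
      rw [← associator_naturality]
      simp
    _ = _ := by
      rw [h, h']
      simp

theorem lin_unit (X : C) (a : G) :
    lin T (𝟙_ (T.Equivariant (⊤ : Subgroup G))) X a ≫ (λ_ ((T.F a).obj X)).hom =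
      (T.F a).map (λ_ X).hom := by
  rw [← left_unitality_hom (T.F a) X, lin, Category.assoc]
  rfl

theorem lin_mul (M : T.Equivariant ⊤) (X : C) {g h k : G} (e : g * h = k) :
    (T.F g).map (lin T M X h) ≫ lin T M ((T.F h).obj X) g ≫ M.X ◁ (T.mul e).hom.app X =
      (T.mul e).hom.app (M.X ⊗ X) ≫ lin T M X k := by
  have h1 := M.mul e (Subgroup.mem_top g) (Subgroup.mem_top h) (Subgroup.mem_top k)
  simp only [lin]
  rw [reassoc_of% mul_δ T e, Functor.map_comp, Category.assoc, Category.assoc,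
    ← δ_natural_left_assoc, ← comp_whiskerRight_assoc, h1, comp_whiskerRight_assoc,
    ← whisker_exchange, MonoidalCategory.tensorHom_def, Category.assoc]

variable {L : Subgroup G}

theorem action_act (M : T.Equivariant ⊤) (V : T.Equivariant L) (g : G) (hg : g ∈ L) :
    (M ⊙ₗ V : T.Equivariant L).act g hg = lin T M V.X g ≫ M.X ◁ V.act g hg := by
  change δ (T.F g) M.X V.X ≫ (M.act g _ ⊗ₘ V.act g hg) = _
  simp [lin, MonoidalCategory.tensorHom_def]

theorem transfer_lin (M : T.Equivariant ⊤) (V : T.Equivariant L) (a b : G) (h : b⁻¹ * a ∈ L) :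
    transfer (M ⊙ₗ V : T.Equivariant L) a b h ≫ lin T M V.X b =
      lin T M V.X a ≫ M.X ◁ transfer V a b h := by
  have e : b * (b⁻¹ * a) = a := by group
  have h1 := mul_transfer (M ⊙ₗ V : T.Equivariant L) e h h
  have h2 := lin_mul M V.X e
  rw [← cancel_epi ((T.mul e).hom.app (M.X ⊗ V.X))]
  refine (Category.assoc _ _ _).symm.trans ?_
  refine (congrArg (· ≫ lin T M V.X b) h1).trans ?_
  rw [action_act]
  rw [← reassoc_of% h2, ← whiskerLeft_comp, mul_transfer V e h h, Functor.map_comp,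
    Category.assoc, lin_natural_right]

theorem shift_lin (M : T.Equivariant ⊤) (V : T.Equivariant L) (g a b : G)
    (h : b⁻¹ * (g * a) ∈ L) :
    shift (M ⊙ₗ V : T.Equivariant L) g a b h ≫ lin T M V.X b =
      (T.F g).map (lin T M V.X a) ≫ lin T M ((T.F a).obj V.X) g ≫ M.X ◁ shift V g a b h := by
  rw [shift, shift, Category.assoc, transfer_lin, whiskerLeft_comp]
  have h1 := lin_mul M V.X (rfl : g * a = g * a)
  have h2 := congrArg (· ≫ M.X ◁ transfer V (g * a) b h) h1
  simp only [Category.assoc] at h2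
  exact h2.symm

end lin

end Monoidal

/-! ## Module functors -/

section Linear

variable {D : Type*} [Category* D] {D' : Type*} [Category* D'] {D'' : Type*} [Category* D'']
  {A : Type*} [Category* A] [MonoidalCategory A]
  [MonoidalLeftAction A D] [MonoidalLeftAction A D'] [MonoidalLeftAction A D'']

/-- A module functor structure on `F`, from isomorphisms `F (a ⊠ d) ≅ a ⊠ F d` that are natural
and compatible with the associativity and unit constraints. -/
abbrev leftLinearOfIso (F : D ⥤ D') (e : ∀ (a : A) (d : D), F.obj (a ⊙ₗ d) ≅ a ⊙ₗ F.obj d)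
    (hl : ∀ {a a' : A} (f : a ⟶ a') (d : D),
      F.map (f ⊵ₗ d) ≫ (e a' d).hom = (e a d).hom ≫ f ⊵ₗ F.obj d)
    (hr : ∀ (a : A) {d d' : D} (f : d ⟶ d'),
      F.map (a ⊴ₗ f) ≫ (e a d').hom = (e a d).hom ≫ a ⊴ₗ F.map f)
    (ha : ∀ (a a' : A) (d : D), (e (a ⊗ a') d).hom ≫ (αₗ _ _ _).hom =
      F.map (αₗ _ _ _).hom ≫ (e a (a' ⊙ₗ d)).hom ≫ a ⊴ₗ (e a' d).hom)
    (hu : ∀ d : D, (e (𝟙_ A) d).hom ≫ (λₗ[A] (F.obj d)).hom = F.map (λₗ[A] d).hom) :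
    F.LeftLinear A where
  μₗ a d := (e a d).inv
  δₗ a d := (e a d).hom
  μₗ_naturality_left f d := by
    rw [← cancel_epi (e _ _).hom, ← reassoc_of% hl f d]
    simp
  μₗ_naturality_right a _ _ f := by
    rw [← cancel_epi (e _ _).hom, ← reassoc_of% hr a f]
    simp
  μₗ_associativity a a' d := by
    rw [← cancel_epi (e _ _).hom, reassoc_of% ha a a' d]
    simp
  μₗ_unitality d := by
    rw [← cancel_epi (e _ _).hom, hu]
    simp
  δₗ_naturality_left f d := hl f d
  δₗ_naturality_right a _ _ f := hr a f
  δₗ_associativity a a' d := ha a a' d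
  δₗ_unitality_inv d := by
    rw [← cancel_mono (λₗ[A] (F.obj d)).hom, Category.assoc, hu, ← Functor.map_comp]
    simp
  μₗ_comp_δₗ a d := (e a d).inv_hom_id
  δₗ_comp_μₗ a d := (e a d).hom_inv_id

open Functor.OplaxLeftLinear Functor.LaxLeftLinear

/-- The composite of two module functors, with
`G (F (a ⊠ d)) ⟶ G (a ⊠ F d) ⟶ a ⊠ G (F d)`. -/
instance (F : D ⥤ D') (F' : D' ⥤ D'') [F.LeftLinear A] [F'.LeftLinear A] :
    (F ⋙ F').LeftLinear A :=
  leftLinearOfIso (F ⋙ F')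
    (fun a d => F'.mapIso (Functor.LeftLinear.μₗIso F a d).symm ≪≫
      (Functor.LeftLinear.μₗIso F' a (F.obj d)).symm)
    (fun f d => by
      simp only [Functor.comp_obj, Functor.comp_map, Iso.trans_hom, Functor.mapIso_hom,
        Iso.symm_hom, Category.assoc, ← δₗ_naturality_left, ← Functor.map_comp_assoc])
    (fun a _ _ f => by
      simp only [Functor.comp_obj, Functor.comp_map, Iso.trans_hom, Functor.mapIso_hom,
        Iso.symm_hom, Category.assoc, ← δₗ_naturality_right, ← Functor.map_comp_assoc])
    (fun a a' d => by
      have h := δₗ_naturality_right F' a (δₗ F a' d)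
      have h' := congrArg F'.map (δₗ_associativity F a a' d)
      simp only [Functor.map_comp] at h'
      simp only [Functor.comp_obj, Functor.comp_map, Iso.trans_hom, Functor.mapIso_hom,
        Iso.symm_hom, Category.assoc, MonoidalLeftAction.actionHomRight_comp]
      rw [δₗ_associativity, reassoc_of% h', reassoc_of% h])
    (fun d => by
      have h := congrArg F'.map (δₗ_unitality_hom F (C := A) d)
      rw [Functor.map_comp] at h
      simp only [Functor.comp_obj, Functor.comp_map, Iso.trans_hom, Functor.mapIso_hom,
        Iso.symm_hom, Category.assoc]
      rw [δₗ_unitality_hom, h])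

/-- A natural transformation `τ : F ⟶ F'` is a morphism of module functors if the squares with
sides `F (a ⊠ d) ⟶ a ⊠ F d` and `F' (a ⊠ d) ⟶ a ⊠ F' d` commute. -/
def IsModuleNatTrans (A : Type*) [Category* A] [MonoidalCategory A]
    [MonoidalLeftAction A D] [MonoidalLeftAction A D'] {F F' : D ⥤ D'}
    [F.LeftLinear A] [F'.LeftLinear A] (τ : F ⟶ F') : Prop :=
  ∀ (a : A) (d : D), δₗ F a d ≫ a ⊴ₗ τ.app d = τ.app (a ⊙ₗ d) ≫ δₗ F' a d

theorem additive_biproduct_ext {E E' : Type*} [Category* E] [Category* E'] [Preadditive E]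
    [Preadditive E'] (F : E ⥤ E') [F.Additive] {J : Type*} [Finite J] (f : J → E)
    [HasBiproduct f] {X : E'} {g h : X ⟶ F.obj (⨁ f)}
    (w : ∀ j, g ≫ F.map (biproduct.π f j) = h ≫ F.map (biproduct.π f j)) : g = h := by
  have := Fintype.ofFinite J
  have key : ∀ k : X ⟶ F.obj (⨁ f),
      k = ∑ j, k ≫ F.map (biproduct.π f j) ≫ F.map (biproduct.ι f j) := by
    intro k
    rw [← Preadditive.comp_sum]
    simp only [← Functor.map_comp]
    rw [← Functor.map_sum]
    have h := IsBilimit.total (biproduct.isBilimit f)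
    simp only [biproduct.bicone_π, biproduct.bicone_ι] at h
    rw [h]
    simp
  rw [key g, key h]
  refine Finset.sum_congr rfl fun j _ => ?_
  rw [reassoc_of% w j]

theorem additive_biproduct_desc_π {E E' : Type*} [Category* E] [Category* E'] [Preadditive E]
    [Preadditive E'] (F : E ⥤ E') [F.Additive] {J : Type*} (X : J → E') (f : J → E)
    [HasBiproduct X] [HasBiproduct f] (e : ∀ j, X j ≅ F.obj (f j)) (i : J) :
    (biproduct.desc fun j => (e j).hom ≫ F.map (biproduct.ι f j)) ≫ F.map (biproduct.π f i) =
      biproduct.π X i ≫ (e i).hom := by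
  classical
  apply biproduct.hom_ext'
  intro j
  by_cases h : j = i
  · subst h
    simp [← Functor.map_comp]
  · simp [← Functor.map_comp, biproduct.ι_π_ne _ h, biproduct.ι_π_ne_assoc _ h]

/-- The isomorphism `⨁ X j ≅ F (⨁ f j)` induced by isomorphisms `X j ≅ F (f j)`, for an additive
functor `F`. -/
noncomputable def additiveBiproductIso {E E' : Type*} [Category* E] [Category* E'] [Preadditive E]
    [Preadditive E'] (F : E ⥤ E') [F.Additive] {J : Type*} [Finite J] (X : J → E') (f : J → E)
    [HasBiproduct X] [HasBiproduct f] (e : ∀ j, X j ≅ F.obj (f j)) :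
    ⨁ X ≅ F.obj (⨁ f) where
  hom := biproduct.desc fun j => (e j).hom ≫ F.map (biproduct.ι f j)
  inv := biproduct.lift fun j => F.map (biproduct.π f j) ≫ (e j).inv
  hom_inv_id := by
    apply biproduct.hom_ext
    intro i
    rw [Category.assoc, biproduct.lift_π, reassoc_of% additive_biproduct_desc_π F X f e i]
    simp
  inv_hom_id := by
    apply additive_biproduct_ext F f
    intro i
    rw [Category.assoc, additive_biproduct_desc_π F X f e i, biproduct.lift_π_assoc]
    simp

theorem additiveBiproductIso_hom_π {E E' : Type*} [Category* E] [Category* E'] [Preadditive E]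
    [Preadditive E'] (F : E ⥤ E') [F.Additive] {J : Type*} [Finite J] (X : J → E') (f : J → E)
    [HasBiproduct X] [HasBiproduct f] (e : ∀ j, X j ≅ F.obj (f j)) (j : J) :
    (additiveBiproductIso F X f e).hom ≫ F.map (biproduct.π f j) =
      biproduct.π X j ≫ (e j).hom :=
  additive_biproduct_desc_π F X f e j

end Linear

section

variable [MonoidalCategory C] {T : CatGroupAction G C} [T.MonoidalAction] {H : Subgroup G} (M : T.Equivariant (⊤ : Subgroup G)) (V : T.Equivariant H)

@[simp] theorem action_X : (M ⊙ₗ V : T.Equivariant H).X = M.X ⊗ V.X := rfl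
@[simp] theorem actionHomLeft_hom {M N : T.Equivariant (⊤ : Subgroup G)} (f : M ⟶ N) :
    (f ⊵ₗ V).hom = f.hom ▷ V.X := rfl
@[simp] theorem actionHomRight_hom {V W : T.Equivariant H} (f : V ⟶ W) :
    (M ⊴ₗ f).hom = M.X ◁ f.hom := rfl
@[simp] theorem actionAssocIso_hom_hom (N : T.Equivariant (⊤ : Subgroup G)) :
    (αₗ M N V).hom.hom = (α_ M.X N.X V.X).hom := rfl
@[simp] theorem actionUnitIso_hom_hom :
    (λₗ[T.Equivariant (⊤ : Subgroup G)] V).hom.hom = (λ_ V.X).hom := rfl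

end

section ModuleFunctors

variable [Abelian C] [MonoidalCategory C] [MonoidalPreadditive C]

attribute [local instance] Abelian.hasFiniteBiproducts

theorem whiskerLeft_indX_ext [Finite G] {T : CatGroupAction G C} {L H : Subgroup G}
    (r : LeftCosetReps L H) (V : T.Equivariant L) {X Y : C} {g h : X ⟶ Y ⊗ indX T r V}
    (w : ∀ q, g ≫ Y ◁ biproduct.π _ q = h ≫ Y ◁ biproduct.π _ q) : g = h :=
  additive_biproduct_ext (tensorLeft Y) _ w

variable {T : CatGroupAction G C} [T.MonoidalAction]

/-- The restriction functor is a module functor, with the identity structure. -/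
instance {K H : Subgroup G} (h : K ≤ H) : (T.res h).LeftLinear (T.Equivariant (⊤ : Subgroup G)) :=
  leftLinearOfIso (T.res h)
    (fun _ _ => Iso.refl _)
    (fun f V => by ext; simp)
    (fun M _ _ f => by ext; simp)
    (fun M N V => by ext; simp)
    (fun V => by ext; simp)

/-- The conjugation functor is a module functor, with
`T x (M ⊗ V) ⟶ T x M ⊗ T x V ⟶ M ⊗ T x V`. -/
noncomputable instance (L : Subgroup G) (x : G) :
    (T.conj L x).LeftLinear (T.Equivariant (⊤ : Subgroup G)) :=
  leftLinearOfIso (T.conj L x)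
    (fun M V => Equivariant.isoMk (linIso M V.X x) (fun g hg => by
      rw [action_act]
      exact (shift_lin M V g x x (mem_conjSubgroup.1 hg)).symm))
    (fun f V => Equivariant.hom_ext (lin_natural_left f V.X x))
    (fun M _ _ f => Equivariant.hom_ext (lin_natural_right M f.hom x))
    (fun M N V => Equivariant.hom_ext (lin_assoc M N V.X x))
    (fun V => Equivariant.hom_ext (lin_unit V.X x))

section Ind

variable [Finite G] {L H : Subgroup G} (r : LeftCosetReps L H)

/-- The isomorphism `⨁ T t (M ⊗ V) ≅ M ⊗ ⨁ T t V` with components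
`T t (M ⊗ V) ⟶ T t M ⊗ T t V ⟶ M ⊗ T t V`. -/
noncomputable def indLin (M : T.Equivariant ⊤) (V : T.Equivariant L) :
    indX T r (M ⊙ₗ V) ≅ M.X ⊗ indX T r V :=
  additiveBiproductIso (tensorLeft M.X)
    (fun q : H ⧸ L.subgroupOf H => (T.F (r.rep q : G)).obj (M.X ⊗ V.X))
    (fun q : H ⧸ L.subgroupOf H => (T.F (r.rep q : G)).obj V.X)
    (fun q => linIso M V.X (r.rep q : G))

theorem indLin_π (M : T.Equivariant ⊤) (V : T.Equivariant L) (q : H ⧸ L.subgroupOf H) :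
    (indLin r M V).hom ≫ M.X ◁ biproduct.π _ q =
      biproduct.π (fun q : H ⧸ L.subgroupOf H => (T.F (r.rep q : G)).obj (M.X ⊗ V.X)) q ≫
        lin T M V.X (r.rep q : G) :=
  additiveBiproductIso_hom_π (tensorLeft M.X)
    (fun q : H ⧸ L.subgroupOf H => (T.F (r.rep q : G)).obj (M.X ⊗ V.X))
    (fun q : H ⧸ L.subgroupOf H => (T.F (r.rep q : G)).obj V.X)
    (fun q => linIso M V.X (r.rep q : G)) q

theorem indLin_comm (M : T.Equivariant ⊤) (V : T.Equivariant L) (g : G) (hg : g ∈ H) :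
    (T.F g).map (indLin r M V).hom ≫ lin T M (indX T r V) g ≫ M.X ◁ indAct T r V g hg =
      indAct T r (M ⊙ₗ V) g hg ≫ (indLin r M V).hom := by
  apply whiskerLeft_indX_ext r V
  intro s
  have e : (⟨g, hg⟩ : H) • ((⟨g, hg⟩ : H)⁻¹ • s) = s := smul_inv_smul _ _
  have h1 := indAct_π T r V g hg e
  have h2 := indAct_π T r (M ⊙ₗ V : T.Equivariant L) g hg e
  have h3 := indLin_π r M V s
  have h4 := congrArg (T.F g).map (indLin_π r M V ((⟨g, hg⟩ : H)⁻¹ • s))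
  have h5 := shift_lin M V g _ _ (r.mem e)
  have h6 := lin_natural_right M (biproduct.π
    (fun q : H ⧸ L.subgroupOf H => (T.F (r.rep q : G)).obj V.X) ((⟨g, hg⟩ : H)⁻¹ • s)) g
  rw [Functor.map_comp, Functor.map_comp] at h4
  calc
    _ = (T.F g).map (indLin r M V).hom ≫ lin T M (indX T r V) g ≫
        M.X ◁ (T.F g).map (biproduct.π _ ((⟨g, hg⟩ : H)⁻¹ • s)) ≫
        M.X ◁ shift V g (r.rep ((⟨g, hg⟩ : H)⁻¹ • s)) (r.rep s) (r.mem e) := by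
      rw [Category.assoc, Category.assoc, ← whiskerLeft_comp, h1, whiskerLeft_comp]
    _ = (T.F g).map (biproduct.π _ ((⟨g, hg⟩ : H)⁻¹ • s)) ≫
        shift (M ⊙ₗ V : T.Equivariant L) g (r.rep ((⟨g, hg⟩ : H)⁻¹ • s)) (r.rep s) (r.mem e) ≫
        lin T M V.X (r.rep s : G) := by
      rw [← reassoc_of% h6, reassoc_of% h4, h5]
      rfl
    _ = _ := by
      rw [Category.assoc, h3]
      have h7 := h2 =≫ lin T M V.X (r.rep s : G)
      simp only [Category.assoc] at h7
      exact h7.symm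

/-- The isomorphism `Ind_L^H (M ⊠ V) ≅ M ⊠ Ind_L^H V`. -/
noncomputable def indLinIso (M : T.Equivariant ⊤) (V : T.Equivariant L) :
    (T.ind r).obj (M ⊙ₗ V) ≅ (M ⊙ₗ (T.ind r).obj V : T.Equivariant H) :=
  Equivariant.isoMk (indLin r M V) (by
    intro g hg
    rw [action_act]
    exact indLin_comm r M V g hg)

theorem indLin_natural_left {M N : T.Equivariant ⊤} (f : M ⟶ N) (V : T.Equivariant L) :
    indMap T r (f ⊵ₗ V) ≫ (indLin r N V).hom = (indLin r M V).hom ≫ f.hom ▷ indX T r V := by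
  apply whiskerLeft_indX_ext r V
  intro s
  have h1 := indLin_π r M V s
  have h2 := lin_natural_left f V.X (r.rep s : G)
  rw [Category.assoc, Category.assoc, indLin_π, ← whisker_exchange, reassoc_of% h1, ← h2]
  exact biproduct.map_π_assoc _ _ _

theorem indLin_natural_right (M : T.Equivariant ⊤) {V W : T.Equivariant L} (f : V ⟶ W) :
    indMap T r (M ⊴ₗ f) ≫ (indLin r M W).hom = (indLin r M V).hom ≫ M.X ◁ indMap T r f := by
  apply whiskerLeft_indX_ext r W
  intro s
  have h1 := indLin_π r M V s
  have h2 := lin_natural_right M f.hom (r.rep s : G)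
  rw [Category.assoc, Category.assoc, indLin_π, ← whiskerLeft_comp, biproduct.map_π,
    whiskerLeft_comp, reassoc_of% h1, ← h2]
  exact biproduct.map_π_assoc _ _ _

theorem indLin_assoc (M N : T.Equivariant ⊤) (V : T.Equivariant L) :
    (indLin r (M ⊗ N) V).hom ≫ (α_ M.X N.X (indX T r V)).hom =
      indMap T r (αₗ M N V).hom ≫ (indLin r M (N ⊙ₗ V)).hom ≫ M.X ◁ (indLin r N V).hom := by
  rw [← cancel_mono (α_ M.X N.X (indX T r V)).inv]
  apply whiskerLeft_indX_ext r V
  intro s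
  have h1 := indLin_π r (M ⊗ N) V s
  have h2 := lin_assoc M N V.X (r.rep s : G)
  have h3 := indLin_π r N V s
  have h4 := indLin_π r M (N ⊙ₗ V : T.Equivariant L) s
  have h5 := h4 =≫ M.X ◁ lin T N V.X (r.rep s : G)
  simp only [Category.assoc] at h5
  simp only [Category.assoc, Iso.hom_inv_id_assoc]
  refine h1.trans ?_
  rw [← cancel_mono (α_ M.X N.X _).hom, Category.assoc, h2]
  simp only [Category.assoc, MonoidalCategory.tensor_whiskerLeft, Iso.inv_hom_id_assoc,
    Iso.inv_hom_id, Category.comp_id]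
  rw [← whiskerLeft_comp, h3, whiskerLeft_comp]
  refine Eq.trans ?_ (congrArg (indMap T r (αₗ M N V).hom ≫ ·) h5).symm
  have h6 : indMap T r (αₗ M N V).hom ≫
      biproduct.π (fun q : H ⧸ L.subgroupOf H => (T.F (r.rep q : G)).obj (M.X ⊗ N.X ⊗ V.X)) s =
      biproduct.π (fun q : H ⧸ L.subgroupOf H =>
        (T.F (r.rep q : G)).obj ((M.X ⊗ N.X) ⊗ V.X)) s ≫
        (T.F (r.rep s : G)).map (α_ M.X N.X V.X).hom := biproduct.map_π _ _
  have h7 := h6 =≫ (lin T M (N.X ⊗ V.X) (r.rep s : G) ≫ M.X ◁ lin T N V.X (r.rep s : G))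
  simp only [Category.assoc] at h7
  exact h7.symm

theorem indLin_unit (V : T.Equivariant L) :
    (indLin r (𝟙_ (T.Equivariant (⊤ : Subgroup G))) V).hom ≫ (λ_ (indX T r V)).hom =
      indMap T r (λₗ[T.Equivariant (⊤ : Subgroup G)] V).hom := by
  apply biproduct.hom_ext
  intro s
  have h1 := indLin_π r (𝟙_ (T.Equivariant (⊤ : Subgroup G))) V s
  have h2 := lin_unit (T := T) V.X (r.rep s : G)
  rw [Category.assoc, ← leftUnitor_naturality, biproduct.map_π]
  have h3 := h1 =≫ (λ_ ((T.F (r.rep s : G)).obj V.X)).hom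
  simp only [Category.assoc] at h3
  refine h3.trans ?_
  rw [h2]
  rfl

/-- The induction functor is a module functor, with components
`T t (M ⊗ V) ⟶ T t M ⊗ T t V ⟶ M ⊗ T t V`. -/
noncomputable instance : (T.ind r).LeftLinear (T.Equivariant (⊤ : Subgroup G)) :=
  leftLinearOfIso (T.ind r) (indLinIso r)
    (fun f V => Equivariant.hom_ext (indLin_natural_left r f V))
    (fun M _ _ f => Equivariant.hom_ext (indLin_natural_right r M f))
    (fun M N V => Equivariant.hom_ext (indLin_assoc r M N V))
    (fun V => Equivariant.hom_ext (indLin_unit r V))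

end Ind

section Sum

variable {K : Subgroup G} {D : Type*} [Category* D]
  [MonoidalLeftAction (T.Equivariant (⊤ : Subgroup G)) D]
  {J : Type*} [Finite J] (F : J → D ⥤ T.Equivariant K)
  [∀ j, (F j).LeftLinear (T.Equivariant (⊤ : Subgroup G))]

instance (V : T.Equivariant K) : (tensorLeft V).Additive where
  map_add {_ _ f g} := by ext; simp

theorem action_biproduct_ext (M : T.Equivariant (⊤ : Subgroup G)) (V : J → T.Equivariant K)
    {W : T.Equivariant K} {f g : W ⟶ M ⊙ₗ ⨁ V}
    (w : ∀ j, f ≫ M ⊴ₗ biproduct.π V j = g ≫ M ⊴ₗ biproduct.π V j) : f = g :=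
  additive_biproduct_ext (tensorLeft ((T.res le_top).obj M)) V w

/-- The isomorphism `⨁ F j (M ⊠ d) ≅ M ⊠ ⨁ F j d` with components `F j (M ⊠ d) ≅ M ⊠ F j d`. -/
noncomputable def sumLinIso (M : T.Equivariant (⊤ : Subgroup G)) (d : D) :
    (functorSum F).obj (M ⊙ₗ d) ≅ (M ⊙ₗ (functorSum F).obj d : T.Equivariant K) :=
  additiveBiproductIso (tensorLeft ((T.res le_top).obj M))
    (fun j => (F j).obj (M ⊙ₗ d)) (fun j => (F j).obj d)
    (fun j => (Functor.LeftLinear.μₗIso (F j) M d).symm)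

open Functor.OplaxLeftLinear

theorem sumLinIso_π (M : T.Equivariant (⊤ : Subgroup G)) (d : D) (j : J) :
    (sumLinIso F M d).hom ≫ M ⊴ₗ biproduct.π (fun j => (F j).obj d) j =
      biproduct.π (fun j => (F j).obj (M ⊙ₗ d)) j ≫ δₗ (F j) M d :=
  additiveBiproductIso_hom_π (tensorLeft ((T.res le_top).obj M))
    (fun j => (F j).obj (M ⊙ₗ d)) (fun j => (F j).obj d)
    (fun j => (Functor.LeftLinear.μₗIso (F j) M d).symm) j

/-- A finite direct sum of module functors is a module functor, with components
`F j (M ⊠ d) ≅ M ⊠ F j d`. -/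
noncomputable instance : (functorSum F).LeftLinear (T.Equivariant (⊤ : Subgroup G)) :=
  leftLinearOfIso (functorSum F) (sumLinIso F)
    (fun {M N} f d => by
      apply action_biproduct_ext
      intro j
      have h1 := sumLinIso_π F M d j
      have h2 := sumLinIso_π F N d j
      rw [Category.assoc, Category.assoc, h2, ← MonoidalLeftAction.action_exchange,
        reassoc_of% h1, ← δₗ_naturality_left, reassoc_of% functorSum_map_π F (f ⊵ₗ d) j])
    (fun M d d' f => by
      apply action_biproduct_ext
      intro j
      have h1 := sumLinIso_π F M d j
      have h2 := sumLinIso_π F M d' j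
      rw [Category.assoc, Category.assoc, h2, ← MonoidalLeftAction.actionHomRight_comp,
        functorSum_map_π F f j, MonoidalLeftAction.actionHomRight_comp, reassoc_of% h1,
        ← δₗ_naturality_right, reassoc_of% functorSum_map_π F (M ⊴ₗ f) j])
    (fun M N d => by
      apply additive_biproduct_ext
        (tensorLeft ((T.res le_top).obj N) ⋙ tensorLeft ((T.res le_top).obj M))
      intro j
      change _ ≫ M ⊴ₗ N ⊴ₗ biproduct.π _ j = _ ≫ M ⊴ₗ N ⊴ₗ biproduct.π _ j
      have h1 := sumLinIso_π F M (N ⊙ₗ d) j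
      have h2 := sumLinIso_π F N d j
      have h3 := sumLinIso_π F (M ⊗ N) d j
      rw [MonoidalLeftAction.tensor_actionHomRight, ← Category.assoc, ← Category.assoc,
        Iso.comp_inv_eq] at h3
      rw [h3]
      simp only [Category.assoc]
      rw [← MonoidalLeftAction.actionHomRight_comp, h2, δₗ_associativity,
        MonoidalLeftAction.actionHomRight_comp, reassoc_of% h1,
        reassoc_of% functorSum_map_π F (αₗ M N d).hom j])
    (fun d => by
      apply biproduct.hom_ext
      intro j
      have h3 := sumLinIso_π F (𝟙_ (T.Equivariant (⊤ : Subgroup G))) d j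
      rw [MonoidalLeftAction.unit_actionHomRight, ← Category.assoc, ← Category.assoc,
        Iso.comp_inv_eq] at h3
      rw [h3, functorSum_map_π F _ j, Category.assoc, δₗ_unitality_hom])

end Sum

end ModuleFunctors

end CatGroupAction

/-!
For `V` in `C^L`, both sides of the Mackey formula are direct sums of objects `T a V`, where `a`
runs over a set of representatives of `H / L`. For `Res_K^H (Ind_L^H V)` this is the given set.
The summand at a double coset representative `x` is a sum of objects `T u (T x V)`, with `u` in the
given set of representatives of `K / (K ∩ ˣL)`, and `T₂^{u,x}` identifies it with a sum of objects
`T (u x) V`; the products `u x` represent `H / L` (`doubleCosetMap_bijective`).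

On either side, in terms of the projections to the objects `T a V`, the element `g ∈ K` acts by the
maps `shift V g a b : T g (T a V) ⟶ T b V` (`indRes_act_proj`, `mackeySummand_act_proj`). Two sets
of representatives of `H / L` are compared by the invertible maps `transfer V a b : T a V ⟶ T b V`
for `a L = b L`. They are natural in `V`, and they commute with `shift` (`map_transfer_shift`), so
that they define the isomorphism `mackeyIso` in `C^K`.

The monoidal structure does not enter the construction of `mackeyIso`. When there is one, in terms
of the same projections the module structures of both sides have the components
`lin : T a (M ⊗ V) ⟶ M ⊗ T a V` (`δₗ_indRes_proj`, `δₗ_mackeySummand_proj`; for `a = u x` because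
`T₂^{u,x}` is monoidal), and `transfer` commutes with `lin` by `transfer_lin`. Hence `mackeyIso` is
an isomorphism of module functors.
-/

namespace CatGroupAction

/-! ### Double cosets and left cosets -/

section Cosets

variable {G : Type w} [Group G] {K L H : Subgroup G}

/-- The map sending a double coset `q` with representative `x` and a coset `p` in `K / (K ∩ ˣL)` with
representative `u` to the coset `u x L` in `H / L`. -/
def doubleCosetMap (hK : K ≤ H) (d : DoubleCosetReps K L H)
    (s : ∀ q, LeftCosetReps (K ⊓ conjSubgroup (d.rep q : G) L) K)
    (j : Σ q, K ⧸ (K ⊓ conjSubgroup (d.rep q : G) L).subgroupOf K) : H ⧸ L.subgroupOf H :=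
  QuotientGroup.mk (Subgroup.inclusion hK ((s j.1).rep j.2) * d.rep j.1)

variable (hK : K ≤ H) (d : DoubleCosetReps K L H)
  (s : ∀ q, LeftCosetReps (K ⊓ conjSubgroup (d.rep q : G) L) K)

theorem doubleCosetMap_mem (r : LeftCosetReps L H)
    (j : Σ q, K ⧸ (K ⊓ conjSubgroup (d.rep q : G) L).subgroupOf K) :
    (((s j.1).rep j.2 : G) * (d.rep j.1 : G))⁻¹ * (r.rep (doubleCosetMap hK d s j) : G) ∈ L :=
  Subgroup.mem_subgroupOf.1 (QuotientGroup.eq.1 (r.mk_rep (doubleCosetMap hK d s j)).symm)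

theorem mem_of_doubleCosetMap_eq (r : LeftCosetReps L H)
    {j : Σ q, K ⧸ (K ⊓ conjSubgroup (d.rep q : G) L).subgroupOf K}
    {c : H ⧸ L.subgroupOf H} (h : doubleCosetMap hK d s j = c) :
    (r.rep c : G)⁻¹ * (((s j.1).rep j.2 : G) * (d.rep j.1 : G)) ∈ L := by
  subst h
  simpa using L.inv_mem (doubleCosetMap_mem hK d s r j)

/-- For each double coset `q` the map `p ↦ doubleCosetMap ⟨q, p⟩` is `K`-equivariant. -/
theorem doubleCosetMap_smul (q : DoubleCoset.Quotient (K.subgroupOf H : Set H)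
      (L.subgroupOf H : Set H)) {g : G} (hg : g ∈ K)
    {p p' : K ⧸ (K ⊓ conjSubgroup (d.rep q : G) L).subgroupOf K}
    (e : (⟨g, hg⟩ : K) • p' = p) :
    (⟨g, hK hg⟩ : H) • doubleCosetMap hK d s ⟨q, p'⟩ = doubleCosetMap hK d s ⟨q, p⟩ := by
  have h := mem_conjSubgroup.1 (Subgroup.mem_inf.1 ((s q).mem e)).2
  refine (QuotientGroup.eq.2 (Subgroup.mem_subgroupOf.2 ?_)).symm
  simpa [mul_assoc] using h

theorem doubleCosetMap_bijective :
    Function.Bijective (doubleCosetMap hK d s) := by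
  constructor
  · rintro ⟨q, p⟩ ⟨q', p'⟩ h
    have h1 := Subgroup.mem_subgroupOf.1 (QuotientGroup.eq.1 h)
    -- `u x L = u' x' L` implies `x' = (u'⁻¹ u) x l` with `l ∈ L`, so that `x` and `x'` represent the
    -- same double coset.
    obtain rfl : q = q' := by
      rw [← d.mk_rep q, ← d.mk_rep q', DoubleCoset.eq]
      refine ⟨Subgroup.inclusion hK (((s q').rep p')⁻¹ * (s q).rep p), ?_, _, QuotientGroup.eq.1 h,
        ?_⟩
      · exact Subgroup.mem_subgroupOf.2 (((s q').rep p')⁻¹ * (s q).rep p).2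
      · simp [mul_assoc]
    congr 1
    rw [← (s q).mk_rep p, ← (s q).mk_rep p']
    refine QuotientGroup.eq.2 (Subgroup.mem_subgroupOf.2 ⟨Subtype.property _, ?_⟩)
    refine mem_conjSubgroup.2 ?_
    simpa [mul_assoc] using h1
  · intro c
    obtain ⟨h, rfl⟩ := QuotientGroup.mk_surjective c
    let q := DoubleCoset.mk (K.subgroupOf H) (L.subgroupOf H) h
    obtain ⟨k, hk, l, hl, e⟩ := (DoubleCoset.eq _ _ _ _).1 (d.mk_rep q)
    have hk' : (k : G) ∈ K := Subgroup.mem_subgroupOf.1 hk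
    refine ⟨⟨q, QuotientGroup.mk ⟨k, hk'⟩⟩, ?_⟩
    have h1 := Subgroup.mem_subgroupOf.1 (QuotientGroup.eq.1
      ((s q).mk_rep (QuotientGroup.mk ⟨k, hk'⟩)))
    have h2 := L.mul_mem (mem_conjSubgroup.1 (Subgroup.mem_inf.1 h1).2)
      (Subgroup.mem_subgroupOf.1 hl)
    refine QuotientGroup.eq.2 (Subgroup.mem_subgroupOf.2 ?_)
    rw [e]
    simpa [mul_assoc] using h2

end Cosets

/-! ### Transfer along a conjugation -/

section Transfer

variable {G : Type w} [Group G] {C : Type u} [Category.{v} C] {T : CatGroupAction G C}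
  {L : Subgroup G}

/-- A morphism `i : W ⟶ T x V` that is equivariant for `c_{L,x} V`, restricted to a subgroup of
`x L x⁻¹`, turns the transfer maps of `W` into those of `V`. -/
theorem transfer_comp_mul (V : T.Equivariant L) {L' : Subgroup G} (W : T.Equivariant L') {x : G}
    (hL' : ∀ g ∈ L', x⁻¹ * (g * x) ∈ L) (i : W.X ⟶ (T.F x).obj V.X)
    (hi : ∀ (g : G) (hg : g ∈ L'), (T.F g).map i ≫ shift V g x x (hL' g hg) = W.act g hg ≫ i)
    {a b ax bx : G} (ea : a * x = ax) (eb : b * x = bx) (h : b⁻¹ * a ∈ L') (h' : bx⁻¹ * ax ∈ L) :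
    transfer W a b h ≫ (T.F b).map i ≫ (T.mul eb).hom.app V.X =
      (T.F a).map i ≫ (T.mul ea).hom.app V.X ≫ transfer V ax bx h' := by
  have e₁ : b * (b⁻¹ * a) = a := by group
  have e₂ : b * ((b⁻¹ * a) * x) = ax := by rw [← ea]; group
  have h1 := mul_transfer W e₁ h h
  have h2 := T.assoc e₁ ea rfl e₂ V.X
  have h3 := map_transfer V e₂ eb (hL' _ h) h'
  rw [← cancel_epi ((T.mul e₁).hom.app W.X), reassoc_of% h1, ← NatTrans.naturality_assoc,
    reassoc_of% h2, ← h3, Functor.comp_map, ← Functor.map_comp_assoc, ← hi, shift]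
  simp

/-- As in `transfer_comp_mul`, a morphism `i : W ⟶ T x V` that is equivariant for `c_{L,x} V` turns
the shift maps of `W` into those of `V`. -/
theorem shift_comp_mul (V : T.Equivariant L) {L' : Subgroup G} (W : T.Equivariant L') {x : G}
    (hL' : ∀ g ∈ L', x⁻¹ * (g * x) ∈ L) (i : W.X ⟶ (T.F x).obj V.X)
    (hi : ∀ (g : G) (hg : g ∈ L'), (T.F g).map i ≫ shift V g x x (hL' g hg) = W.act g hg ≫ i)
    {g a b ax bx : G} (ea : a * x = ax) (eb : b * x = bx) (h : b⁻¹ * (g * a) ∈ L')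
    (h' : bx⁻¹ * (g * ax) ∈ L) :
    shift W g a b h ≫ (T.F b).map i ≫ (T.mul eb).hom.app V.X =
      (T.F g).map ((T.F a).map i ≫ (T.mul ea).hom.app V.X) ≫ shift V g ax bx h' := by
  have e : g * a * x = g * ax := by rw [← ea, mul_assoc]
  have h1 := (T.mul (rfl : g * a = g * a)).hom.naturality i
  rw [Functor.comp_map] at h1
  rw [shift, shift, Category.assoc, transfer_comp_mul V W hL' i hi e eb h h', ← reassoc_of% h1,
    reassoc_of% T.assoc rfl e ea rfl V.X]
  simp

/-- Changing the representatives `a, a'` of two left cosets of `L` to `b, b'` commutes with the map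
`shift` by which `g` acts from the first coset to the second. -/
theorem map_transfer_shift (V : T.Equivariant L) {g a b a' b' : G} (h₁ : b⁻¹ * a ∈ L)
    (h₂ : b'⁻¹ * (g * b) ∈ L) (h₃ : a'⁻¹ * (g * a) ∈ L) (h₄ : b'⁻¹ * a' ∈ L) :
    (T.F g).map (transfer V a b h₁) ≫ shift V g b b' h₂ =
      shift V g a a' h₃ ≫ transfer V a' b' h₄ := by
  have h₅ : (g * b)⁻¹ * (g * a) ∈ L := by simpa [mul_assoc] using h₁
  have h₆ : b'⁻¹ * (g * a) ∈ L := by simpa [mul_assoc] using L.mul_mem h₄ h₃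
  rw [shift, shift, ← Category.assoc, map_transfer V rfl rfl h₁ h₅, Category.assoc,
    Category.assoc, transfer_trans V h₅ h₂ h₆, transfer_trans V h₃ h₄ h₆]

end Transfer

/-! ### The projections of an induced object -/

section Ind

variable {G : Type w} [Group G] [Finite G] {C : Type u} [Category.{v} C] [Abelian C]
  {T : CatGroupAction G C} {L H : Subgroup G} (s : LeftCosetReps L H)

attribute [local instance] Abelian.hasFiniteBiproducts

/-- The projection of `Ind_L^H V` to the summand `T t V`, as a morphism out of the underlying object
of `(T.ind s).obj V`. -/
noncomputable def indProj (V : T.Equivariant L) (p : H ⧸ L.subgroupOf H) :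
    ((T.ind s).obj V).X ⟶ (T.F (s.rep p : G)).obj V.X :=
  biproduct.π (fun p : H ⧸ L.subgroupOf H => (T.F (s.rep p : G)).obj V.X) p

/-- The morphism to `Ind_L^H V` with given components. -/
noncomputable def indLift (V : T.Equivariant L) {X : C}
    (f : ∀ p, X ⟶ (T.F (s.rep p : G)).obj V.X) : X ⟶ ((T.ind s).obj V).X :=
  biproduct.lift f

theorem indLift_indProj (V : T.Equivariant L) {X : C}
    (f : ∀ p, X ⟶ (T.F (s.rep p : G)).obj V.X) (p : H ⧸ L.subgroupOf H) :
    indLift s V f ≫ indProj s V p = f p :=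
  biproduct.lift_π _ _

theorem indProj_ext (V : T.Equivariant L) {X : C} {f g : X ⟶ ((T.ind s).obj V).X}
    (w : ∀ p, f ≫ indProj s V p = g ≫ indProj s V p) : f = g :=
  biproduct.hom_ext _ _ w

theorem ind_map_indProj {V W : T.Equivariant L} (f : V ⟶ W) (p : H ⧸ L.subgroupOf H) :
    ((T.ind s).map f).hom ≫ indProj s W p = indProj s V p ≫ (T.F (s.rep p : G)).map f.hom :=
  biproduct.map_π (fun p : H ⧸ L.subgroupOf H => (T.F (s.rep p : G)).map f.hom) p

theorem act_indProj (V : T.Equivariant L) (g : G) (hg : g ∈ H) {p p' : H ⧸ L.subgroupOf H}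
    (e : (⟨g, hg⟩ : H) • p' = p) :
    ((T.ind s).obj V).act g hg ≫ indProj s V p =
      (T.F g).map (indProj s V p') ≫ shift V g (s.rep p') (s.rep p) (s.mem e) :=
  indAct_π T s V g hg e

variable [MonoidalCategory C] [MonoidalPreadditive C]

theorem whiskerLeft_indProj_ext (V : T.Equivariant L) {X Y : C}
    {f g : X ⟶ Y ⊗ ((T.ind s).obj V).X}
    (w : ∀ p, f ≫ Y ◁ indProj s V p = g ≫ Y ◁ indProj s V p) : f = g :=
  whiskerLeft_indX_ext s V w

variable [T.MonoidalAction]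

open Functor.OplaxLeftLinear

theorem δₗ_ind_indProj (M : T.Equivariant (⊤ : Subgroup G)) (V : T.Equivariant L)
    (p : H ⧸ L.subgroupOf H) :
    (δₗ (T.ind s) M V).hom ≫ M.X ◁ indProj s V p =
      indProj s (M ⊙ₗ V) p ≫ lin T M V.X (s.rep p : G) :=
  indLin_π s M V p

end Ind

/-! ### Induction of objects of the form `T x V` -/

section IndConj

variable {G : Type w} [Group G] [Finite G] {C : Type u} [Category.{v} C] [Abelian C]
  {T : CatGroupAction G C} {L L' K : Subgroup G} {x : G} (s : LeftCosetReps L' K)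

/-- For `i : W ⟶ T x Y`, the composite of the projection of the induced object of `W` to `T u W` and
of `T u W ⟶ T u (T x Y) ⟶ T (u x) Y`. -/
noncomputable def indProjMul (W : T.Equivariant L') {Y : C} (i : W.X ⟶ (T.F x).obj Y)
    (p : K ⧸ L'.subgroupOf K) :
    ((T.ind s).obj W).X ⟶ (T.F ((s.rep p : G) * x)).obj Y :=
  indProj s W p ≫ (T.F (s.rep p : G)).map i ≫ (T.mul rfl).hom.app Y

/-- The morphism to the induced object of `W ≅ T x Y` with given components in `T (u x) Y`. -/
noncomputable def indLiftMul (W : T.Equivariant L') {Y : C} (i : W.X ⟶ (T.F x).obj Y)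
    [IsIso i] {X : C} (f : ∀ p, X ⟶ (T.F ((s.rep p : G) * x)).obj Y) :
    X ⟶ ((T.ind s).obj W).X :=
  indLift s W fun p => f p ≫ (T.mul rfl).inv.app Y ≫ (T.F (s.rep p : G)).map (inv i)

theorem indLiftMul_indProjMul (W : T.Equivariant L') {Y : C} (i : W.X ⟶ (T.F x).obj Y)
    [IsIso i] {X : C} (f : ∀ p, X ⟶ (T.F ((s.rep p : G) * x)).obj Y) (p : K ⧸ L'.subgroupOf K) :
    indLiftMul s W i f ≫ indProjMul s W i p = f p := by
  rw [indProjMul, indLiftMul, reassoc_of% indLift_indProj s W, Category.assoc,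
    Category.assoc, ← Functor.map_comp_assoc]
  simp

theorem indProjMul_ext (W : T.Equivariant L') {Y : C} (i : W.X ⟶ (T.F x).obj Y) [IsIso i]
    {X : C} {f g : X ⟶ ((T.ind s).obj W).X}
    (w : ∀ p, f ≫ indProjMul s W i p = g ≫ indProjMul s W i p) : f = g := by
  refine indProj_ext s W fun p => ?_
  have h := w p
  rw [indProjMul, ← Category.assoc, ← Category.assoc g] at h
  exact (cancel_mono _).1 h

theorem ind_map_indProjMul {W W' : T.Equivariant L'} {Y Y' : C} {i : W.X ⟶ (T.F x).obj Y}
    {i' : W'.X ⟶ (T.F x).obj Y'} (φ : W ⟶ W') (f : Y ⟶ Y')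
    (h : φ.hom ≫ i' = i ≫ (T.F x).map f) (p : K ⧸ L'.subgroupOf K) :
    ((T.ind s).map φ).hom ≫ indProjMul s W' i' p =
      indProjMul s W i p ≫ (T.F ((s.rep p : G) * x)).map f := by
  have h1 := ind_map_indProj s φ p
  have h2 := (T.mul (rfl : (s.rep p : G) * x = (s.rep p : G) * x)).hom.naturality f
  rw [Functor.comp_map] at h2
  rw [indProjMul, indProjMul, reassoc_of% h1, ← Functor.map_comp_assoc, h,
    Functor.map_comp_assoc, h2]
  simp only [Category.assoc]

/-- If `i : W ⟶ T x V` is equivariant for `c_{L,x} V`, then in terms of the projections `indProjMul`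
the element `g` acts on the induced object of `W` by the maps `shift` of `V`. -/
theorem act_indProjMul (W : T.Equivariant L') (V : T.Equivariant L)
    (hL' : ∀ g ∈ L', x⁻¹ * (g * x) ∈ L) (i : W.X ⟶ (T.F x).obj V.X)
    (hi : ∀ (g : G) (hg : g ∈ L'), (T.F g).map i ≫ shift V g x x (hL' g hg) = W.act g hg ≫ i)
    (g : G) (hg : g ∈ K) {p p' : K ⧸ L'.subgroupOf K} (e : (⟨g, hg⟩ : K) • p' = p)
    (h : ((s.rep p : G) * x)⁻¹ * (g * ((s.rep p' : G) * x)) ∈ L) :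
    ((T.ind s).obj W).act g hg ≫ indProjMul s W i p =
      (T.F g).map (indProjMul s W i p') ≫
        shift V g ((s.rep p' : G) * x) ((s.rep p : G) * x) h := by
  have h1 := act_indProj s W g hg e
  have h2 := shift_comp_mul V W hL' i hi rfl rfl (s.mem e) h
  rw [indProjMul, indProjMul, reassoc_of% h1, h2, ← Functor.map_comp_assoc]

open Functor.OplaxLeftLinear

variable [MonoidalCategory C] [MonoidalPreadditive C]

theorem whiskerLeft_indProjMul_ext (W : T.Equivariant L') {Y : C} (i : W.X ⟶ (T.F x).obj Y)
    [IsIso i] {X Z : C} {f g : X ⟶ Z ⊗ ((T.ind s).obj W).X}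
    (w : ∀ p, f ≫ Z ◁ indProjMul s W i p = g ≫ Z ◁ indProjMul s W i p) : f = g := by
  refine whiskerLeft_indProj_ext s W fun p => ?_
  have h := w p
  rw [indProjMul, whiskerLeft_comp, ← Category.assoc, ← Category.assoc g] at h
  exact (cancel_mono _).1 h

variable [T.MonoidalAction]

/-- If `φ : W' ⟶ M ⊠ W` corresponds to `lin : T x (M ⊗ Y) ⟶ M ⊗ T x Y`, then in terms of the
projections `indProjMul` the module structure of induction, composed with `φ`, has the components
`lin : T (u x) (M ⊗ Y) ⟶ M ⊗ T (u x) Y`. -/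
theorem δₗ_ind_indProjMul (M : T.Equivariant (⊤ : Subgroup G)) {W W' : T.Equivariant L'} {Y : C}
    {i : W.X ⟶ (T.F x).obj Y} {i' : W'.X ⟶ (T.F x).obj (M.X ⊗ Y)} (φ : W' ⟶ M ⊙ₗ W)
    (h : φ.hom ≫ M.X ◁ i = i' ≫ lin T M Y x) (p : K ⧸ L'.subgroupOf K) :
    ((T.ind s).map φ ≫ δₗ (T.ind s) M W).hom ≫ M.X ◁ indProjMul s W i p =
      indProjMul s W' i' p ≫ lin T M Y ((s.rep p : G) * x) := by
  have h1 := δₗ_ind_indProj s M W p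
  have h2 := ind_map_indProj s φ p
  have h3 := lin_natural_right M i (s.rep p : G)
  have h4 := congrArg (T.F (s.rep p : G)).map h
  rw [Functor.map_comp, Functor.map_comp] at h4
  rw [indProjMul, indProjMul, whiskerLeft_comp, whiskerLeft_comp, Equivariant.comp_hom,
    Category.assoc, reassoc_of% h1, ← reassoc_of% h3, reassoc_of% h2, reassoc_of% h4,
    lin_mul, Category.assoc, Category.assoc]

end IndConj

/-! ### The two sides of the Mackey formula -/

section Mackey

variable {G : Type w} [Group G] [Finite G] {C : Type u} [Category.{v} C] [Abelian C]
  (T : CatGroupAction G C) {K L H : Subgroup G} (hK : K ≤ H)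
  (r : LeftCosetReps L H) (d : DoubleCosetReps K L H)
  (s : ∀ q, LeftCosetReps (K ⊓ conjSubgroup (d.rep q : G) L) K)

/-- The identity of `T x V`, as a morphism out of the underlying object of `c_{L,x} V`. -/
def conjHom (x : G) (V : T.Equivariant L) : ((T.conj L x).obj V).X ⟶ (T.F x).obj V.X := 𝟙 _

instance (x : G) (V : T.Equivariant L) : IsIso (T.conjHom x V) :=
  inferInstanceAs (IsIso (𝟙 ((T.F x).obj V.X)))

/-- The functor `V ↦ Res_K^H (Ind_L^H V)`. It is not reducible, so that its values are only used
through the projections `indResProj`; likewise for `mackeySummand`. -/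
noncomputable def indRes : T.Equivariant L ⥤ T.Equivariant K := T.ind r ⋙ T.res hK

/-- The summand `V ↦ Ind_{K ∩ ˣL}^K (Res (c_{L,x} V))` of the Mackey formula at a double
coset `q` with representative `x`. -/
noncomputable def mackeySummand
    (q : DoubleCoset.Quotient (K.subgroupOf H : Set H) (L.subgroupOf H : Set H)) :
    T.Equivariant L ⥤ T.Equivariant K :=
  T.conj L (d.rep q : G) ⋙ T.res inf_le_right ⋙ T.ind (s q)

/-- The projection of `Res_K^H (Ind_L^H V)` to `T t V`. -/
noncomputable def indResProj (V : T.Equivariant L) (c : H ⧸ L.subgroupOf H) :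
    ((T.indRes hK r).obj V).X ⟶ (T.F (r.rep c : G)).obj V.X :=
  indProj r V c

/-- The projection of the summand at `q` to `T u (T x V) ≅ T (u x) V`. -/
noncomputable def mackeySummandProj
    (q : DoubleCoset.Quotient (K.subgroupOf H : Set H) (L.subgroupOf H : Set H))
    (V : T.Equivariant L) (p : K ⧸ (K ⊓ conjSubgroup (d.rep q : G) L).subgroupOf K) :
    ((T.mackeySummand d s q).obj V).X ⟶ (T.F (((s q).rep p : G) * (d.rep q : G))).obj V.X :=
  indProjMul (s q) ((T.res inf_le_right).obj ((T.conj L (d.rep q : G)).obj V))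
    (T.conjHom (d.rep q : G) V) p

section Projections

variable {T d} {q : DoubleCoset.Quotient (K.subgroupOf H : Set H) (L.subgroupOf H : Set H)}
  (V : T.Equivariant L)

theorem indRes_map_proj {W : T.Equivariant L} (f : V ⟶ W) (c : H ⧸ L.subgroupOf H) :
    ((T.indRes hK r).map f).hom ≫ T.indResProj hK r W c =
      T.indResProj hK r V c ≫ (T.F (r.rep c : G)).map f.hom :=
  ind_map_indProj r f c

theorem indRes_act_proj (g : G) (hg : g ∈ K) {c c' : H ⧸ L.subgroupOf H}
    (e : (⟨g, hK hg⟩ : H) • c' = c) :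
    ((T.indRes hK r).obj V).act g hg ≫ T.indResProj hK r V c =
      (T.F g).map (T.indResProj hK r V c') ≫ shift V g (r.rep c') (r.rep c) (r.mem e) :=
  act_indProj r V g (hK hg) e

theorem indResProj_ext {X : C} {f g : X ⟶ ((T.indRes hK r).obj V).X}
    (w : ∀ c, f ≫ T.indResProj hK r V c = g ≫ T.indResProj hK r V c) : f = g :=
  indProj_ext r V w

/-- The morphism to the summand at `q` with given components in `T (u x) V`. -/
noncomputable def mackeySummandLift {X : C}
    (f : ∀ p, X ⟶ (T.F (((s q).rep p : G) * (d.rep q : G))).obj V.X) :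
    X ⟶ ((T.mackeySummand d s q).obj V).X :=
  indLiftMul (s q) ((T.res inf_le_right).obj ((T.conj L (d.rep q : G)).obj V))
    (T.conjHom (d.rep q : G) V) f

theorem mackeySummandLift_proj {X : C}
    (f : ∀ p, X ⟶ (T.F (((s q).rep p : G) * (d.rep q : G))).obj V.X)
    (p : K ⧸ (K ⊓ conjSubgroup (d.rep q : G) L).subgroupOf K) :
    mackeySummandLift s V f ≫ T.mackeySummandProj d s q V p = f p :=
  indLiftMul_indProjMul (s q) ((T.res inf_le_right).obj ((T.conj L (d.rep q : G)).obj V))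
    (T.conjHom (d.rep q : G) V) f p

theorem exists_indRes_lift {X : C} (f : ∀ c, X ⟶ (T.F (r.rep c : G)).obj V.X) :
    ∃ φ : X ⟶ ((T.indRes hK r).obj V).X, ∀ c, φ ≫ T.indResProj hK r V c = f c :=
  ⟨indLift r V f, indLift_indProj r V f⟩

theorem mackeySummandProj_ext {X : C} {f g : X ⟶ ((T.mackeySummand d s q).obj V).X}
    (w : ∀ p, f ≫ T.mackeySummandProj d s q V p = g ≫ T.mackeySummandProj d s q V p) : f = g :=
  indProjMul_ext (s q) ((T.res inf_le_right).obj ((T.conj L (d.rep q : G)).obj V))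
    (T.conjHom (d.rep q : G) V) w

theorem mackeySummand_map_proj {W : T.Equivariant L} (f : V ⟶ W)
    (p : K ⧸ (K ⊓ conjSubgroup (d.rep q : G) L).subgroupOf K) :
    ((T.mackeySummand d s q).map f).hom ≫ T.mackeySummandProj d s q W p =
      T.mackeySummandProj d s q V p ≫ (T.F (((s q).rep p : G) * (d.rep q : G))).map f.hom :=
  ind_map_indProjMul (s q) ((T.res inf_le_right).map ((T.conj L (d.rep q : G)).map f)) f.hom
    ((Category.comp_id _).trans (Category.id_comp _).symm) p

theorem mackeySummand_act_proj (g : G) (hg : g ∈ K)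
    {p p' : K ⧸ (K ⊓ conjSubgroup (d.rep q : G) L).subgroupOf K} (e : (⟨g, hg⟩ : K) • p' = p)
    (h : (((s q).rep p : G) * (d.rep q : G))⁻¹ * (g * (((s q).rep p' : G) * (d.rep q : G))) ∈ L) :
    ((T.mackeySummand d s q).obj V).act g hg ≫ T.mackeySummandProj d s q V p =
      (T.F g).map (T.mackeySummandProj d s q V p') ≫ shift V g _ _ h :=
  act_indProjMul (s q) ((T.res inf_le_right).obj ((T.conj L (d.rep q : G)).obj V)) V
    (fun _ hg => mem_conjSubgroup.1 (Subgroup.mem_inf.1 hg).2) (T.conjHom (d.rep q : G) V)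
    (fun g _ => ((congrArg (· ≫ _) ((T.F g).map_id _)).trans (Category.id_comp _)).trans
      (Category.comp_id _).symm) g hg e h

open Functor.OplaxLeftLinear

variable [MonoidalCategory C] [MonoidalPreadditive C]

theorem whiskerLeft_mackeySummandProj_ext {X Z : C}
    {f g : X ⟶ Z ⊗ ((T.mackeySummand d s q).obj V).X}
    (w : ∀ p, f ≫ Z ◁ T.mackeySummandProj d s q V p = g ≫ Z ◁ T.mackeySummandProj d s q V p) :
    f = g :=
  whiskerLeft_indProjMul_ext (s q)
    ((T.res inf_le_right).obj ((T.conj L (d.rep q : G)).obj V))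
    (T.conjHom (d.rep q : G) V) w

variable [T.MonoidalAction]

noncomputable instance : (T.indRes hK r).LeftLinear (T.Equivariant (⊤ : Subgroup G)) :=
  inferInstanceAs ((T.ind r ⋙ T.res hK).LeftLinear (T.Equivariant (⊤ : Subgroup G)))

noncomputable instance : (T.mackeySummand d s q).LeftLinear (T.Equivariant (⊤ : Subgroup G)) :=
  inferInstanceAs ((T.conj L (d.rep q : G) ⋙ T.res inf_le_right ⋙ T.ind (s q)).LeftLinear
    (T.Equivariant (⊤ : Subgroup G)))

theorem δₗ_indRes_proj (M : T.Equivariant (⊤ : Subgroup G)) (c : H ⧸ L.subgroupOf H) :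
    (δₗ (T.indRes hK r) M V).hom ≫ M.X ◁ T.indResProj hK r V c =
      T.indResProj hK r (M ⊙ₗ V) c ≫ lin T M V.X (r.rep c : G) :=
  (congrArg (· ≫ _) (Category.comp_id (δₗ (T.ind r) M V).hom)).trans (δₗ_ind_indProj r M V c)

/-- In terms of the projections to `T (u x) V`, the module structure of the summand at `q` has the
components `lin : T (u x) (M ⊗ V) ⟶ M ⊗ T (u x) V`. -/
theorem δₗ_mackeySummand_proj (M : T.Equivariant (⊤ : Subgroup G))
    (p : K ⧸ (K ⊓ conjSubgroup (d.rep q : G) L).subgroupOf K) :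
    (δₗ (T.mackeySummand d s q) M V).hom ≫ M.X ◁ T.mackeySummandProj d s q V p =
      T.mackeySummandProj d s q (M ⊙ₗ V) p ≫
        lin T M V.X (((s q).rep p : G) * (d.rep q : G)) := by
  have h : δₗ (T.mackeySummand d s q) M V =
      (T.ind (s q)).map ((T.res inf_le_right).map (δₗ (T.conj L (d.rep q : G)) M V)) ≫
        δₗ (T.ind (s q)) M ((T.res inf_le_right).obj ((T.conj L (d.rep q : G)).obj V)) := by
    -- The module structure of the restriction functor is the identity.
    change _ ≫ (T.ind (s q)).map (𝟙 _) ≫ _ = _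
    exact congrArg ((T.ind (s q)).map ((T.res inf_le_right).map
      (δₗ (T.conj L (d.rep q : G)) M V)) ≫ ·)
      ((congrArg (· ≫ _) ((T.ind (s q)).map_id _)).trans (Category.id_comp _))
  have h' : (δₗ (T.conj L (d.rep q : G)) M V).hom ≫
      M.X ◁ T.conjHom (d.rep q : G) V =
      T.conjHom (d.rep q : G) (M ⊙ₗ V) ≫ lin T M V.X (d.rep q : G) :=
    ((congrArg (lin T M V.X (d.rep q : G) ≫ ·) (whiskerLeft_id _ _)).trans
      (Category.comp_id _)).trans (Category.id_comp _).symm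
  rw [h]
  exact δₗ_ind_indProjMul (s q) M
    (W := (T.res inf_le_right).obj ((T.conj L (d.rep q : G)).obj V))
    (W' := (T.res inf_le_right).obj ((T.conj L (d.rep q : G)).obj (M ⊙ₗ V)))
    (i := T.conjHom (d.rep q : G) V) (i' := T.conjHom (d.rep q : G) (M ⊙ₗ V))
    ((T.res inf_le_right).map (δₗ (T.conj L (d.rep q : G)) M V)) h' p

end Projections

/-! ### The Mackey isomorphism -/

/-- The component of the Mackey isomorphism at the double coset `q`. Its component in `T (u x) V` is
`transfer : T t V ⟶ T (u x) V`, where `t` represents the coset of `u x`. -/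
noncomputable def mackeyProj (V : T.Equivariant L)
    (q : DoubleCoset.Quotient (K.subgroupOf H : Set H) (L.subgroupOf H : Set H)) :
    (T.indRes hK r).obj V ⟶ (T.mackeySummand d s q).obj V where
  hom := mackeySummandLift s V fun p =>
    T.indResProj hK r V (doubleCosetMap hK d s ⟨q, p⟩) ≫
      transfer V _ _ (doubleCosetMap_mem hK d s r ⟨q, p⟩)
  comm g hg := by
    apply mackeySummandProj_ext
    intro p
    have e : (⟨g, hg⟩ : K) • ((⟨g, hg⟩ : K)⁻¹ • p) = p := smul_inv_smul _ _
    have e' := doubleCosetMap_smul hK d s q hg e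
    have h1 := indRes_act_proj hK r V g hg e'
    have h : (((s q).rep p : G) * (d.rep q : G))⁻¹ *
        (g * (((s q).rep ((⟨g, hg⟩ : K)⁻¹ • p) : G) * (d.rep q : G))) ∈ L := by
      simpa [mul_assoc] using mem_conjSubgroup.1 (Subgroup.mem_inf.1 ((s q).mem e)).2
    rw [Category.assoc, Category.assoc, mackeySummand_act_proj s V g hg e h,
      ← Functor.map_comp_assoc, mackeySummandLift_proj, mackeySummandLift_proj,
      Functor.map_comp, Category.assoc,
      map_transfer_shift V _ _ (r.mem e') (doubleCosetMap_mem hK d s r ⟨q, p⟩), reassoc_of% h1]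

theorem mackeyProj_hom_proj (V : T.Equivariant L)
    (q : DoubleCoset.Quotient (K.subgroupOf H : Set H) (L.subgroupOf H : Set H))
    (p : K ⧸ (K ⊓ conjSubgroup (d.rep q : G) L).subgroupOf K) :
    (mackeyProj T hK r d s V q).hom ≫ T.mackeySummandProj d s q V p =
      T.indResProj hK r V (doubleCosetMap hK d s ⟨q, p⟩) ≫
        transfer V _ _ (doubleCosetMap_mem hK d s r ⟨q, p⟩) :=
  mackeySummandLift_proj s V _ p

theorem mackeyProj_naturality {V W : T.Equivariant L} (f : V ⟶ W)
    (q : DoubleCoset.Quotient (K.subgroupOf H : Set H) (L.subgroupOf H : Set H)) :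
    (T.indRes hK r).map f ≫ mackeyProj T hK r d s W q =
      mackeyProj T hK r d s V q ≫ (T.mackeySummand d s q).map f := by
  apply Equivariant.hom_ext
  apply mackeySummandProj_ext
  intro p
  have h1 := mackeyProj_hom_proj T hK r d s V q p
  have h3 := indRes_map_proj hK r V f (doubleCosetMap hK d s ⟨q, p⟩)
  rw [Equivariant.comp_hom, Equivariant.comp_hom, Category.assoc, Category.assoc,
    mackeyProj_hom_proj, reassoc_of% h3, transfer_naturality, mackeySummand_map_proj,
    reassoc_of% h1]

/-- The morphism underlying the Mackey isomorphism at `V`. -/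
noncomputable def mackeyHom (V : T.Equivariant L) :
    (T.indRes hK r).obj V ⟶ (functorSum (T.mackeySummand d s)).obj V :=
  biproduct.lift (mackeyProj T hK r d s V)

theorem mackeyHom_π (V : T.Equivariant L)
    (q : DoubleCoset.Quotient (K.subgroupOf H : Set H) (L.subgroupOf H : Set H)) :
    mackeyHom T hK r d s V ≫ biproduct.π (fun q => (T.mackeySummand d s q).obj V) q =
      mackeyProj T hK r d s V q :=
  biproduct.lift_π _ _

theorem mackeyHom_naturality {V W : T.Equivariant L} (f : V ⟶ W) :
    (T.indRes hK r).map f ≫ mackeyHom T hK r d s W =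
      mackeyHom T hK r d s V ≫ (functorSum (T.mackeySummand d s)).map f := by
  apply biproduct.hom_ext
  intro q
  have h1 := functorSum_map_π (T.mackeySummand d s) f q
  have h2 := mackeyHom_π T hK r d s V q
  rw [Category.assoc, Category.assoc, mackeyHom_π, h1, reassoc_of% h2, mackeyProj_naturality]

/-- The projection of the right hand side of the Mackey formula to `T (u x) V`. -/
noncomputable def mackeySumProj (V : T.Equivariant L)
    (j : Σ q, K ⧸ (K ⊓ conjSubgroup (d.rep q : G) L).subgroupOf K) :
    ((functorSum (T.mackeySummand d s)).obj V).X ⟶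
      (T.F (((s j.1).rep j.2 : G) * (d.rep j.1 : G))).obj V.X :=
  (biproduct.π (fun q => (T.mackeySummand d s q).obj V) j.1).hom ≫
    T.mackeySummandProj d s j.1 V j.2

theorem mackeySumProj_ext {V : T.Equivariant L} {X : C}
    {f g : X ⟶ ((functorSum (T.mackeySummand d s)).obj V).X}
    (w : ∀ j, f ≫ mackeySumProj T d s V j = g ≫ mackeySumProj T d s V j) : f = g := by
  refine additive_biproduct_ext (Equivariant.forget T K) (fun q => (T.mackeySummand d s q).obj V)
    fun q => ?_
  refine mackeySummandProj_ext s V fun p => ?_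
  exact (Category.assoc _ _ _).trans ((w ⟨q, p⟩).trans (Category.assoc _ _ _).symm)

theorem mackeyHom_hom_sumProj (V : T.Equivariant L)
    (j : Σ q, K ⧸ (K ⊓ conjSubgroup (d.rep q : G) L).subgroupOf K) :
    (mackeyHom T hK r d s V).hom ≫ mackeySumProj T d s V j =
      T.indResProj hK r V (doubleCosetMap hK d s j) ≫
        transfer V _ _ (doubleCosetMap_mem hK d s r j) := by
  have h := congrArg Equivariant.Hom.hom (mackeyHom_π T hK r d s V j.1)
  rw [Equivariant.comp_hom] at h
  rw [← mackeyProj_hom_proj, ← h, mackeySumProj, Category.assoc]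

instance isIso_mackeyHom_hom (V : T.Equivariant L) : IsIso (mackeyHom T hK r d s V).hom := by
  -- The inverse has the components `transfer : T (u x) V ⟶ T t V`.
  let σ := Equiv.ofBijective _ (doubleCosetMap_bijective hK d s)
  obtain ⟨ψ, hψ⟩ := exists_indRes_lift hK r V fun c => mackeySumProj T d s V (σ.symm c) ≫
    transfer V _ _ (mem_of_doubleCosetMap_eq hK d s r (σ.apply_symm_apply c))
  have hψ' : ∀ j, ψ ≫ T.indResProj hK r V (doubleCosetMap hK d s j) =
      mackeySumProj T d s V j ≫ transfer V _ _ (mem_of_doubleCosetMap_eq hK d s r rfl) := by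
    -- The equality with `c` is generalized, so that it can be used to eliminate `j`.
    have key : ∀ j c (h : doubleCosetMap hK d s j = c), ψ ≫ T.indResProj hK r V c =
        mackeySumProj T d s V j ≫ transfer V _ _ (mem_of_doubleCosetMap_eq hK d s r h) := by
      intro j c h
      obtain rfl : j = σ.symm c := (Equiv.eq_symm_apply _).2 h
      exact hψ c
    exact fun j => key j _ rfl
  refine ⟨ψ, indResProj_ext hK r V fun c => ?_, mackeySumProj_ext T d s fun j => ?_⟩
  · obtain ⟨j, rfl⟩ := (doubleCosetMap_bijective hK d s).2 c
    have h := mackeyHom_hom_sumProj T hK r d s V j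
    rw [Category.assoc, hψ', reassoc_of% h, transfer_trans V _ _ (by simp [L.one_mem]),
      transfer_self, Category.comp_id, Category.id_comp]
  · rw [Category.assoc, mackeyHom_hom_sumProj, reassoc_of% hψ' j,
      transfer_trans V _ _ (by simp [L.one_mem]), transfer_self, Category.comp_id,
      Category.id_comp]

/-- The Mackey isomorphism, for arbitrary choices of representatives. -/
noncomputable def mackeyIso : T.indRes hK r ≅ functorSum (T.mackeySummand d s) :=
  NatIso.ofComponents
    (fun V => Equivariant.isoMk (asIso (mackeyHom T hK r d s V).hom) (mackeyHom T hK r d s V).comm)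
    (fun f => mackeyHom_naturality T hK r d s f)

theorem mackeyIso_hom_app (V : T.Equivariant L) :
    (mackeyIso T hK r d s).hom.app V = mackeyHom T hK r d s V := rfl

open Functor.OplaxLeftLinear

variable [MonoidalCategory C] [MonoidalPreadditive C] [T.MonoidalAction]

/-- The components of the Mackey isomorphism are morphisms of module functors. -/
theorem mackeyProj_δₗ (M : T.Equivariant (⊤ : Subgroup G)) (V : T.Equivariant L)
    (q : DoubleCoset.Quotient (K.subgroupOf H : Set H) (L.subgroupOf H : Set H)) :
    δₗ (T.indRes hK r) M V ≫ M ⊴ₗ mackeyProj T hK r d s V q =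
      mackeyProj T hK r d s (M ⊙ₗ V) q ≫ δₗ (T.mackeySummand d s q) M V := by
  apply Equivariant.hom_ext
  refine whiskerLeft_mackeySummandProj_ext s V fun p => ?_
  have h1 := δₗ_indRes_proj hK r V M (doubleCosetMap hK d s ⟨q, p⟩)
  have h2 := δₗ_mackeySummand_proj s V M p
  have h3 := mackeyProj_hom_proj T hK r d s (M ⊙ₗ V) q p
  rw [Equivariant.comp_hom, Equivariant.comp_hom, actionHomRight_hom, Category.assoc,
    Category.assoc, ← whiskerLeft_comp, mackeyProj_hom_proj, whiskerLeft_comp, reassoc_of% h1, h2,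
    reassoc_of% h3, transfer_lin]

theorem mackeyIso_isModuleNatTrans :
    IsModuleNatTrans (T.Equivariant (⊤ : Subgroup G)) (mackeyIso T hK r d s).hom := by
  intro M V
  apply action_biproduct_ext
  intro q
  have h := sumLinIso_π (mackeySummand T d s) M V q
  have h2 := mackeyHom_π T hK r d s (M ⊙ₗ V) q
  rw [mackeyIso_hom_app, mackeyIso_hom_app, Category.assoc, Category.assoc,
    ← MonoidalLeftAction.actionHomRight_comp, mackeyHom_π, mackeyProj_δₗ, ← h2, Category.assoc]
  exact congrArg (mackeyHom T hK r d s (M ⊙ₗ V) ≫ ·) h.symm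

end Mackey

end CatGroupAction

theorem theorem1p2 {G : Type w} [Group G] [Finite G] {C : Type u} [Category.{v} C] [Abelian C]
    (T : CatGroupAction G C) {K L H : Subgroup G} (hK : K ≤ H) (hL : L ≤ H)
    (r : CatGroupAction.LeftCosetReps L H) (d : CatGroupAction.DoubleCosetReps K L H)
    (s : ∀ q, CatGroupAction.LeftCosetReps
      (K ⊓ CatGroupAction.conjSubgroup (d.rep q : G) L) K) :
    ∃ e : T.ind r ⋙ T.res hK ≅
        CatGroupAction.functorSum fun q =>
          T.conj L (d.rep q : G) ⋙ T.res inf_le_right ⋙ T.ind (s q),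
      ∀ (k : Type w') [CommRing k] [Linear k C] [MonoidalCategory C] [MonoidalPreadditive C]
        [MonoidalLinear k C] [T.MonoidalAction] [∀ g, (T.F g).Linear k],
        CatGroupAction.IsModuleNatTrans (T.Equivariant (⊤ : Subgroup G)) e.hom :=
  ⟨CatGroupAction.mackeyIso T hK r d s, by
    intros
    exact CatGroupAction.mackeyIso_isModuleNatTrans T hK r d s⟩
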